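/- **Setting.** A Young function is a convex even function $\Phi:\mathbb R\to[0,\infty]$ with $\Phi(0)=0$, neither identically $0$ nor identically $\infty$ on $(0,\infty)$, and left-continuous at $\sup\{x>0:\Phi(x)<\infty\}$ (when this is finite); $\Phi^*(y)=\sup\{x|y|-\Phi(x):x\ge 0\}$ is its complementary function. We write $\Phi\in\Delta_2$ if there is $K>0$ with $\Phi(2x)\le K\Phi(x)$ for all $x\ge 0$. Let $(X,\Sigma,\mu)$ be a measure space and $\mathcal A\subseteq\Sigma$ a sub-$\sigma$-algebra such that $\mu|_{\mathcal A}$ is $\sigma$-finite. $L^\Phi(\Sigma)$ is the space of (a.e. classes of) $\Sigma$-measurable $f:X\to\mathbb R$ with $\int\Phi(kf)\,d\mu<\infty$ for some $k>0$, with the norm $\|f\|_\Phi=\inf\{k>0:\int\Phi(f/k)\,d\mu\le1\}$; $L^\Psi(\mathcal A)$ is the Orlicz space of $(X,\mathcal A,\mu|_{\mathcal A})$. $E$ is the conditional expectation with respect to $\mathcal A$, defined for all nonnegative $\Sigma$-measurable functions, and by $E(f)=E(f^+)-E(f^-)$ if $E(|f|)<\infty$ a.e. Put $EM_u(f)=E(uf)$.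 Let $\{A_n\}$ be a countable (possibly finite or empty) family of pairwise disjoint atoms of $(X,\mathcal A,\mu|_{\mathcal A})$ such that $B=X\setminus\bigcup_n A_n$ contains no atom of $(X,\mathcal A,\mu|_{\mathcal A})$; for an $\mathcal A$-measurable $g$, $g(A_n)$ is the a.e. constant value of $g$ on $A_n$. **Theorem.** Let $\Phi,\Psi,\Theta$ be Young functions vanishing only at $0$ and taking only finite values, such that $\Psi,\Theta\in\Delta_2$ and $\Psi(xy)\le\Phi(x)+\Theta(y)$ for all $x,y\ge0$. Let $u\in L^\Theta(\Sigma)$ with $u\ge 0$ a.e. Then $E(|uf|)<\infty$ a.e. for every $f\in L^\Phi(\Sigma)$, and $EM_u$ is a bounded linear operator from $L^\Phi(\Sigma)$ into $L^\Psi(\mathcal A)$. Consider the assertions (a) $E(\Phi^*(u))=0$ a.e. on $B$, and the set of those $A_n$ with $E(\Phi^*(u))(A_n)\ne0$ is finite; (b) $EM_u$ has finite rank; (c) $EM_u$ has closed range in $L^\Psi(\mathcal A)$. Then (b) and (c) are equivalent, and (c) implies (a). If $\Phi^*$ also vanishes only at $0$, then (a), (b) and (c) are equivalent. -/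

import Mathlib

open MeasureTheory Set Filter Topology
open scoped ENNReal NNReal

/-- A Young function: a convex even function `Φ : ℝ → [0, ∞]` with `Φ 0 = 0` that is neither
identically zero nor identically infinite on `(0, ∞)`, and that is left-continuous on `(0, ∞)`
(by convexity this only says something at the point `sup {x > 0 | Φ x < ∞}`). -/
structure YoungFunction where
  /-- the underlying function -/
  toFun : ℝ → ℝ≥0∞
  convex' : ConvexOn ℝ≥0 Set.univ toFun
  even' : ∀ x, toFun (-x) = toFun x
  zero' : toFun 0 = 0
  exists_ne_zero' : ∃ x, 0 < x ∧ toFun x ≠ 0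
  exists_ne_top' : ∃ x, 0 < x ∧ toFun x ≠ ∞
  leftCts' : ∀ x, 0 < x → ContinuousWithinAt toFun (Set.Iio x) x

namespace YoungFunction

instance : CoeFun YoungFunction (fun _ => ℝ → ℝ≥0∞) := ⟨YoungFunction.toFun⟩

/-- `Φ` vanishes only at zero. -/
def VanishesOnlyAtZero (Φ : YoungFunction) : Prop := ∀ x, Φ x = 0 → x = 0

/-- `Φ` takes only finite values. -/
def IsFinite (Φ : YoungFunction) : Prop := ∀ x, Φ x ≠ ∞

/-- The (global) `Δ₂`-condition: `Φ (2 x) ≤ K Φ x` for all `x ≥ 0`, for some constant `K > 0`. -/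
def DeltaTwo (Φ : YoungFunction) : Prop :=
  ∃ K : ℝ≥0, 0 < K ∧ ∀ x : ℝ, 0 ≤ x → Φ (2 * x) ≤ K * Φ x

/-- The function complementary to `Φ`: `Φ* y = sup {x |y| - Φ x | x ≥ 0}`, with values in `[0, ∞]`.
The subtraction in `[0, ∞]` is truncated at `0`, which does not change the supremum as the
term with `x = 0` is `0`. -/
noncomputable def compl (Φ : YoungFunction) (y : ℝ) : ℝ≥0∞ :=
  ⨆ (x : ℝ) (_ : 0 ≤ x), (ENNReal.ofReal (x * |y|) - Φ x)

theorem apply_mul_le (Φ : YoungFunction) {t : ℝ} (ht0 : 0 ≤ t) (ht1 : t ≤ 1) (x : ℝ) :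
    Φ (t * x) ≤ ENNReal.ofReal t * Φ x := by
  have h := Φ.convex'.2 (Set.mem_univ x) (Set.mem_univ (0 : ℝ))
    (show (0 : ℝ≥0) ≤ t.toNNReal by simp) (show (0 : ℝ≥0) ≤ (1 - t).toNNReal by simp)
    (by rw [← Real.toNNReal_add ht0 (by linarith)]; simp)
  simpa [Φ.zero', NNReal.smul_def, ENNReal.smul_def, Real.coe_toNNReal _ ht0, ENNReal.ofReal]
    using h

theorem apply_abs (Φ : YoungFunction) (x : ℝ) : Φ |x| = Φ x := by
  rcases abs_choice x with h | h <;> rw [h]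
  exact Φ.even' x

theorem mono_abs (Φ : YoungFunction) {x y : ℝ} (h : |x| ≤ |y|) : Φ x ≤ Φ y := by
  rw [← Φ.apply_abs x, ← Φ.apply_abs y]
  rcases eq_or_lt_of_le (abs_nonneg y) with h0 | h0
  · have : |x| = |y| := le_antisymm h (by rw [← h0]; exact abs_nonneg x)
    rw [this]
  · have ht0 : 0 ≤ |x| / |y| := by positivity
    have ht1 : |x| / |y| ≤ 1 := (div_le_one h0).2 h
    have h1 := Φ.apply_mul_le ht0 ht1 |y|
    rw [div_mul_cancel₀ _ h0.ne'] at h1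
    refine h1.trans ?_
    calc ENNReal.ofReal (|x| / |y|) * Φ |y| ≤ 1 * Φ |y| := by
          gcongr
          exact ENNReal.ofReal_le_one.2 ht1
      _ = Φ |y| := one_mul _

theorem measurable (Φ : YoungFunction) : Measurable (Φ : ℝ → ℝ≥0∞) := by
  have h : Monotone (fun x : ℝ => Φ (max x 0)) := by
    intro x y hxy
    apply Φ.mono_abs
    rw [abs_of_nonneg (le_max_right _ _), abs_of_nonneg (le_max_right _ _)]
    exact max_le_max_right 0 hxy
  have h2 : (Φ : ℝ → ℝ≥0∞) = (fun x : ℝ => Φ (max x 0)) ∘ (fun x : ℝ => |x|) := by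
    funext x
    simp [Φ.apply_abs]
  rw [h2]
  exact h.measurable.comp measurable_norm

theorem apply_convex (Φ : YoungFunction) {s t : ℝ} (hs : 0 ≤ s) (ht : 0 ≤ t) (hst : s + t = 1)
    (x y : ℝ) : Φ (s * x + t * y) ≤ ENNReal.ofReal s * Φ x + ENNReal.ofReal t * Φ y := by
  have h := Φ.convex'.2 (Set.mem_univ x) (Set.mem_univ y)
    (show (0 : ℝ≥0) ≤ s.toNNReal by simp) (show (0 : ℝ≥0) ≤ t.toNNReal by simp)
    (by rw [← Real.toNNReal_add hs ht, hst]; simp)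
  simpa [NNReal.smul_def, ENNReal.smul_def, Real.coe_toNNReal _ hs, Real.coe_toNNReal _ ht,
    ENNReal.ofReal] using h

end YoungFunction

section Orlicz

variable {X : Type*} {m : MeasurableSpace X}

theorem lintegral_young_add_le (Φ : YoungFunction) (μ : Measure X) (f g : X →ₘ[μ] ℝ) {s t : ℝ}
    (hs : 0 ≤ s) (ht : 0 ≤ t) (hst : s + t = 1) :
    ∫⁻ x, Φ (s * f x + t * g x) ∂μ
      ≤ ENNReal.ofReal s * ∫⁻ x, Φ (f x) ∂μ + ENNReal.ofReal t * ∫⁻ x, Φ (g x) ∂μ := by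
  have hf : Measurable fun x => Φ (f x) := Φ.measurable.comp f.measurable
  have hg : Measurable fun x => Φ (g x) := Φ.measurable.comp g.measurable
  rw [← lintegral_const_mul _ hf, ← lintegral_const_mul _ hg,
    ← lintegral_add_left (hf.const_mul _)]
  exact lintegral_mono fun x => Φ.apply_convex hs ht hst _ _

theorem lintegral_young_smul (Φ : YoungFunction) (μ : Measure X) (c : ℝ) (f : X →ₘ[μ] ℝ) (k : ℝ) :
    ∫⁻ x, Φ (k * (c • f : X →ₘ[μ] ℝ) x) ∂μ = ∫⁻ x, Φ ((k * c) * f x) ∂μ := by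
  apply lintegral_congr_ae
  filter_upwards [AEEqFun.coeFn_smul c f] with x hx
  rw [hx, Pi.smul_apply, smul_eq_mul, mul_assoc]

/-- The Orlicz space `L^Φ(μ)` as a linear subspace of the space of classes of measurable
real-valued functions modulo equality almost everywhere: all `f` with `∫ Φ (k f) dμ < ∞` for
some `k > 0`. -/
def orliczSubmodule (Φ : YoungFunction) (μ : Measure X) : Submodule ℝ (X →ₘ[μ] ℝ) where
  carrier := {f | ∃ k : ℝ, 0 < k ∧ ∫⁻ x, Φ (k * f x) ∂μ < ∞}
  zero_mem' := by
    refine ⟨1, one_pos, ?_⟩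
    have : ∫⁻ x, Φ (1 * (0 : X →ₘ[μ] ℝ) x) ∂μ = ∫⁻ x, 0 ∂μ := by
      apply lintegral_congr_ae
      filter_upwards [AEEqFun.coeFn_zero (α := X) (β := ℝ) (μ := μ)] with x hx
      rw [hx]
      simp [Φ.zero']
    rw [this]
    simp
  add_mem' := by
    rintro f g ⟨k, hk, hf⟩ ⟨l, hl, hg⟩
    refine ⟨min k l / 2, by positivity, ?_⟩
    have h1 := lintegral_young_add_le Φ μ (k • f) (l • g) (s := 1 / 2) (t := 1 / 2)
      (by norm_num) (by norm_num) (by norm_num)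
    have e1 : ∫⁻ x, Φ ((k • f : X →ₘ[μ] ℝ) x) ∂μ < ∞ := by
      have := lintegral_young_smul Φ μ k f 1
      simp only [one_mul] at this
      rwa [this]
    have e2 : ∫⁻ x, Φ ((l • g : X →ₘ[μ] ℝ) x) ∂μ < ∞ := by
      have := lintegral_young_smul Φ μ l g 1
      simp only [one_mul] at this
      rwa [this]
    have h2 := lintegral_young_add_le Φ μ (min k l • f) (min k l • g) (s := 1 / 2) (t := 1 / 2)
      (by norm_num) (by norm_num) (by norm_num)
    have hmin : 0 ≤ min k l := by positivity
    have e3 : ∫⁻ x, Φ ((min k l • f : X →ₘ[μ] ℝ) x) ∂μ ≤ ∫⁻ x, Φ ((k • f : X →ₘ[μ] ℝ) x) ∂μ := by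
      apply lintegral_mono_ae
      filter_upwards [AEEqFun.coeFn_smul k f, AEEqFun.coeFn_smul (min k l) f] with x hx hx'
      rw [hx, hx', Pi.smul_apply, Pi.smul_apply, smul_eq_mul, smul_eq_mul]
      apply Φ.mono_abs
      rw [abs_mul, abs_mul, abs_of_nonneg hmin, abs_of_pos hk]
      gcongr
      exact min_le_left _ _
    have e4 : ∫⁻ x, Φ ((min k l • g : X →ₘ[μ] ℝ) x) ∂μ ≤ ∫⁻ x, Φ ((l • g : X →ₘ[μ] ℝ) x) ∂μ := by
      apply lintegral_mono_ae
      filter_upwards [AEEqFun.coeFn_smul l g, AEEqFun.coeFn_smul (min k l) g] with x hx hx'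
      rw [hx, hx', Pi.smul_apply, Pi.smul_apply, smul_eq_mul, smul_eq_mul]
      apply Φ.mono_abs
      rw [abs_mul, abs_mul, abs_of_nonneg hmin, abs_of_pos hl]
      gcongr
      exact min_le_right _ _
    have h3 : ∫⁻ x, Φ (min k l / 2 * (f + g : X →ₘ[μ] ℝ) x) ∂μ
        = ∫⁻ x, Φ (1 / 2 * (min k l • f : X →ₘ[μ] ℝ) x
          + 1 / 2 * (min k l • g : X →ₘ[μ] ℝ) x) ∂μ := by
      apply lintegral_congr_ae
      filter_upwards [AEEqFun.coeFn_add f g, AEEqFun.coeFn_smul (min k l) f,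
        AEEqFun.coeFn_smul (min k l) g] with x h1 h2 h3
      rw [h1, h2, h3]
      simp only [Pi.add_apply, Pi.smul_apply, smul_eq_mul]
      congr 1
      ring
    rw [h3]
    exact h2.trans_lt (ENNReal.add_lt_top.2
      ⟨ENNReal.mul_lt_top ENNReal.ofReal_lt_top (e3.trans_lt e1),
        ENNReal.mul_lt_top ENNReal.ofReal_lt_top (e4.trans_lt e2)⟩)
  smul_mem' := by
    rintro c f ⟨k, hk, hf⟩
    refine ⟨k / (|c| + 1), by positivity, ?_⟩
    rw [lintegral_young_smul]
    refine lt_of_le_of_lt (lintegral_mono fun x => Φ.mono_abs ?_) hf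
    rw [abs_mul, abs_mul k]
    refine mul_le_mul_of_nonneg_right ?_ (abs_nonneg _)
    rw [abs_mul, abs_div, abs_of_pos hk, abs_of_pos (by positivity : 0 < |c| + 1),
      div_mul_eq_mul_div, div_le_iff₀ (by positivity)]
    nlinarith [abs_nonneg c]

/-- The Orlicz space `L^Φ(μ)`. The σ-algebra is the one on which `μ` is defined. -/
def OrliczSpace (Φ : YoungFunction) (μ : Measure X) : Type _ := ↥(orliczSubmodule Φ μ)

namespace OrliczSpace

variable {Φ : YoungFunction} {μ : Measure X}

instance : AddCommGroup (OrliczSpace Φ μ) := inferInstanceAs (AddCommGroup ↥(orliczSubmodule Φ μ))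

instance : Module ℝ (OrliczSpace Φ μ) := inferInstanceAs (Module ℝ ↥(orliczSubmodule Φ μ))

/-- The class of measurable functions modulo a.e. equality underlying an element of `L^Φ(μ)`. -/
def toAEEqFun (f : OrliczSpace Φ μ) : X →ₘ[μ] ℝ := Subtype.val f

/-- The Luxemburg norm `‖f‖_Φ = inf {k > 0 | ∫ Φ (f / k) dμ ≤ 1}`. -/
noncomputable instance : Norm (OrliczSpace Φ μ) :=
  ⟨fun f => sInf {k : ℝ | 0 < k ∧ ∫⁻ x, Φ (f.toAEEqFun x / k) ∂μ ≤ 1}⟩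

theorem norm_def (f : OrliczSpace Φ μ) :
    ‖f‖ = sInf {k : ℝ | 0 < k ∧ ∫⁻ x, Φ (f.toAEEqFun x / k) ∂μ ≤ 1} := rfl

theorem bddBelow_aux (f : OrliczSpace Φ μ) :
    BddBelow {k : ℝ | 0 < k ∧ ∫⁻ x, Φ (f.toAEEqFun x / k) ∂μ ≤ 1} :=
  ⟨0, fun _ hk => hk.1.le⟩

theorem norm_nonneg_aux (f : OrliczSpace Φ μ) : 0 ≤ ‖f‖ :=
  Real.sInf_nonneg fun _ hk => hk.1.le

theorem nonempty_aux (f : OrliczSpace Φ μ) :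
    {k : ℝ | 0 < k ∧ ∫⁻ x, Φ (f.toAEEqFun x / k) ∂μ ≤ 1}.Nonempty := by
  obtain ⟨k, hk, hf⟩ := f.2
  set M := (∫⁻ x, Φ (k * f.toAEEqFun x) ∂μ) with hM
  have hMtop : M ≠ ∞ := hf.ne
  set t : ℝ := 1 / (M.toReal + 1) with ht
  have hM0 : 0 ≤ M.toReal := ENNReal.toReal_nonneg
  have ht0 : 0 < t := by positivity
  have ht1 : t ≤ 1 := by
    rw [ht, div_le_one (by positivity)]
    linarith
  refine ⟨1 / (t * k), by positivity, ?_⟩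
  calc ∫⁻ x, Φ (f.toAEEqFun x / (1 / (t * k))) ∂μ
      ≤ ∫⁻ x, ENNReal.ofReal t * Φ (k * f.toAEEqFun x) ∂μ := by
        apply lintegral_mono
        intro x
        have : f.toAEEqFun x / (1 / (t * k)) = t * (k * f.toAEEqFun x) := by
          field_simp
        simp only [this]
        exact Φ.apply_mul_le ht0.le ht1 _
    _ = ENNReal.ofReal t * M := by
        rw [lintegral_const_mul]
        exact Φ.measurable.comp (f.toAEEqFun.measurable.const_mul k)
    _ = ENNReal.ofReal (t * M.toReal) := by
        rw [ENNReal.ofReal_mul ht0.le, ENNReal.ofReal_toReal hMtop]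
    _ ≤ 1 := by
        rw [ENNReal.ofReal_le_one, ht, div_mul_eq_mul_div, div_le_one (by positivity)]
        linarith

theorem lintegral_le_one_of_norm_lt {f : OrliczSpace Φ μ} {k : ℝ} (hk : ‖f‖ < k) :
    ∫⁻ x, Φ (f.toAEEqFun x / k) ∂μ ≤ 1 := by
  obtain ⟨l, ⟨hl0, hl⟩, hlk⟩ := exists_lt_of_csInf_lt f.nonempty_aux (by rwa [norm_def] at hk)
  refine (lintegral_mono fun x => Φ.mono_abs ?_).trans hl
  rw [abs_div, abs_div, abs_of_pos hl0, abs_of_pos (hl0.trans hlk)]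
  gcongr

theorem norm_le_of_lintegral_le {f : OrliczSpace Φ μ} {k : ℝ} (hk : 0 < k)
    (h : ∫⁻ x, Φ (f.toAEEqFun x / k) ∂μ ≤ 1) : ‖f‖ ≤ k :=
  csInf_le f.bddBelow_aux ⟨hk, h⟩

theorem coe_add (f g : OrliczSpace Φ μ) :
    (f + g).toAEEqFun = f.toAEEqFun + g.toAEEqFun := rfl

theorem coe_smul (c : ℝ) (f : OrliczSpace Φ μ) :
    (c • f).toAEEqFun = c • f.toAEEqFun := rfl

theorem norm_add_le_aux (f g : OrliczSpace Φ μ) : ‖f + g‖ ≤ ‖f‖ + ‖g‖ := by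
  refine le_of_forall_pos_le_add fun ε hε => ?_
  set a := ‖f‖ + ε / 2 with ha
  set b := ‖g‖ + ε / 2 with hb
  have ha0 : 0 < a := by have := f.norm_nonneg_aux; positivity
  have hb0 : 0 < b := by have := g.norm_nonneg_aux; positivity
  have hf : ∫⁻ x, Φ (f.toAEEqFun x / a) ∂μ ≤ 1 := lintegral_le_one_of_norm_lt (by linarith)
  have hg : ∫⁻ x, Φ (g.toAEEqFun x / b) ∂μ ≤ 1 := lintegral_le_one_of_norm_lt (by linarith)
  have hab : ‖f + g‖ ≤ a + b := by
    apply norm_le_of_lintegral_le (by positivity)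
    have hs : a / (a + b) + b / (a + b) = 1 := by field_simp
    have mf : Measurable fun x => Φ (f.toAEEqFun x / a) :=
      Φ.measurable.comp (f.toAEEqFun.measurable.div_const a)
    have mg : Measurable fun x => Φ (g.toAEEqFun x / b) :=
      Φ.measurable.comp (g.toAEEqFun.measurable.div_const b)
    calc ∫⁻ x, Φ ((f + g).toAEEqFun x / (a + b)) ∂μ
        ≤ ∫⁻ x, (ENNReal.ofReal (a / (a + b)) * Φ (f.toAEEqFun x / a)
            + ENNReal.ofReal (b / (a + b)) * Φ (g.toAEEqFun x / b)) ∂μ := by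
          apply lintegral_mono_ae
          rw [coe_add]
          filter_upwards [AEEqFun.coeFn_add f.toAEEqFun g.toAEEqFun] with x hx
          have e : (f.toAEEqFun + g.toAEEqFun) x / (a + b)
              = a / (a + b) * (f.toAEEqFun x / a) + b / (a + b) * (g.toAEEqFun x / b) := by
            rw [hx, Pi.add_apply]
            field_simp
          rw [e]
          exact Φ.apply_convex (by positivity) (by positivity) hs _ _
      _ = ENNReal.ofReal (a / (a + b)) * ∫⁻ x, Φ (f.toAEEqFun x / a) ∂μ
            + ENNReal.ofReal (b / (a + b)) * ∫⁻ x, Φ (g.toAEEqFun x / b) ∂μ := by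
          rw [lintegral_add_left (mf.const_mul _), lintegral_const_mul _ mf,
            lintegral_const_mul _ mg]
      _ ≤ ENNReal.ofReal (a / (a + b)) * 1 + ENNReal.ofReal (b / (a + b)) * 1 := by gcongr
      _ = 1 := by
          rw [mul_one, mul_one, ← ENNReal.ofReal_add (by positivity) (by positivity), hs]
          simp
  linarith

theorem norm_zero_aux : ‖(0 : OrliczSpace Φ μ)‖ = 0 := by
  refine le_antisymm (le_of_forall_pos_le_add fun ε hε => ?_) (norm_nonneg_aux _)
  rw [zero_add]
  apply norm_le_of_lintegral_le hε
  have : ∫⁻ x, Φ ((0 : OrliczSpace Φ μ).toAEEqFun x / ε) ∂μ = ∫⁻ x, 0 ∂μ := by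
    apply lintegral_congr_ae
    have h0 : (0 : OrliczSpace Φ μ).toAEEqFun = 0 := rfl
    rw [h0]
    filter_upwards [AEEqFun.coeFn_zero (α := X) (β := ℝ) (μ := μ)] with x hx
    rw [hx]
    simp [Φ.zero']
  rw [this]
  simp

theorem norm_smul_le_aux (c : ℝ) (f : OrliczSpace Φ μ) : ‖c • f‖ ≤ |c| * ‖f‖ := by
  refine le_of_forall_pos_le_add fun ε hε => ?_
  set k := ‖f‖ + ε / (|c| + 1) with hk
  have hf0 := f.norm_nonneg_aux
  have hk0 : ‖f‖ < k := by
    have : 0 < ε / (|c| + 1) := by positivity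
    linarith
  have hk1 : 0 < k := hf0.trans_lt hk0
  have h1 : |c| * k < |c| * ‖f‖ + ε := by
    have h2 : |c| * (ε / (|c| + 1)) < ε := by
      rw [mul_div_assoc', div_lt_iff₀ (by positivity)]
      nlinarith [abs_nonneg c]
    rw [hk, mul_add]
    linarith
  have h3 : 0 < |c| * ‖f‖ + ε := by positivity
  apply norm_le_of_lintegral_le h3
  refine le_trans ?_ (lintegral_le_one_of_norm_lt hk0)
  apply lintegral_mono_ae
  rw [coe_smul]
  filter_upwards [AEEqFun.coeFn_smul c f.toAEEqFun] with x hx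
  apply Φ.mono_abs
  rw [hx, Pi.smul_apply, smul_eq_mul, abs_div, abs_mul, abs_div, abs_of_pos h3, abs_of_pos hk1,
    div_le_div_iff₀ h3 hk1]
  nlinarith [abs_nonneg (f.toAEEqFun x), abs_nonneg c]

theorem norm_smul_aux (c : ℝ) (f : OrliczSpace Φ μ) : ‖c • f‖ = |c| * ‖f‖ := by
  refine le_antisymm (norm_smul_le_aux c f) ?_
  rcases eq_or_ne c 0 with rfl | hc
  · simp [norm_nonneg_aux]
  · have h := norm_smul_le_aux c⁻¹ (c • f)
    rw [smul_smul, inv_mul_cancel₀ hc, one_smul, abs_inv] at h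
    have hc' : 0 < |c| := abs_pos.2 hc
    calc |c| * ‖f‖ ≤ |c| * (|c|⁻¹ * ‖c • f‖) := by gcongr
      _ = ‖c • f‖ := by field_simp

theorem eq_zero_of_norm_eq_zero_aux (f : OrliczSpace Φ μ) (hf : ‖f‖ = 0) : f = 0 := by
  obtain ⟨y, hy0, hy⟩ := Φ.exists_ne_zero'
  have key : ∀ n : ℕ, ∀ᵐ x ∂μ, Φ ((n : ℝ) * f.toAEEqFun x) = 0 := by
    intro n
    have hm : Measurable fun x => Φ ((n : ℝ) * f.toAEEqFun x) :=
      Φ.measurable.comp (f.toAEEqFun.measurable.const_mul _)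
    suffices h : ∫⁻ x, Φ ((n : ℝ) * f.toAEEqFun x) ∂μ = 0 from (lintegral_eq_zero_iff hm).1 h
    refine le_antisymm (le_of_forall_gt fun e he => ?_) zero_le
    obtain ⟨r, hr0, hr⟩ := ENNReal.lt_iff_exists_real_btwn.1 he
    have hr1 : 0 < r := ENNReal.ofReal_pos.1 hr.1
    set t := min r 1 with ht
    have ht0 : 0 < t := lt_min hr1 one_pos
    have hlt : ‖f‖ < t / (n + 1) := by rw [hf]; positivity
    have h1 := lintegral_le_one_of_norm_lt hlt
    have m1 : Measurable fun x => Φ (f.toAEEqFun x / (t / (n + 1))) :=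
      Φ.measurable.comp (f.toAEEqFun.measurable.div_const _)
    calc ∫⁻ x, Φ ((n : ℝ) * f.toAEEqFun x) ∂μ
        ≤ ∫⁻ x, ENNReal.ofReal t * Φ (f.toAEEqFun x / (t / (n + 1))) ∂μ := by
          apply lintegral_mono
          intro x
          refine le_trans (Φ.mono_abs ?_) (Φ.apply_mul_le ht0.le (min_le_right _ _) _)
          have : t * (f.toAEEqFun x / (t / (n + 1))) = (n + 1) * f.toAEEqFun x := by
            field_simp
          rw [this, abs_mul, abs_mul]
          refine mul_le_mul_of_nonneg_right ?_ (abs_nonneg _)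
          rw [abs_of_nonneg (by positivity), abs_of_nonneg (by positivity)]
          linarith
      _ = ENNReal.ofReal t * ∫⁻ x, Φ (f.toAEEqFun x / (t / (n + 1))) ∂μ :=
          lintegral_const_mul _ m1
      _ ≤ ENNReal.ofReal t * 1 := by gcongr
      _ ≤ ENNReal.ofReal r := by
          rw [mul_one]
          exact ENNReal.ofReal_le_ofReal (min_le_left _ _)
      _ < e := hr.2
  have hz : f.toAEEqFun = 0 := by
    apply AEEqFun.ext
    filter_upwards [ae_all_iff.2 key, AEEqFun.coeFn_zero (α := X) (β := ℝ) (μ := μ)] with x hx h0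
    rw [h0, Pi.zero_apply]
    by_contra hne
    have hpos : 0 < |f.toAEEqFun x| := abs_pos.2 hne
    obtain ⟨n, hn⟩ := exists_nat_gt (y / |f.toAEEqFun x|)
    rw [div_lt_iff₀ hpos] at hn
    apply hy
    refine le_antisymm ?_ zero_le
    calc Φ y ≤ Φ ((n : ℝ) * f.toAEEqFun x) := by
          apply Φ.mono_abs
          rw [abs_mul, abs_of_pos hy0, Nat.abs_cast]
          exact hn.le
      _ = 0 := hx n
  exact Subtype.ext hz

theorem normedSpaceCore (Φ : YoungFunction) (μ : Measure X) :
    NormedSpace.Core ℝ (OrliczSpace Φ μ) where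
  norm_nonneg := norm_nonneg_aux
  norm_smul c f := norm_smul_aux c f
  norm_triangle := norm_add_le_aux
  norm_eq_zero_iff f :=
    ⟨eq_zero_of_norm_eq_zero_aux f, by rintro rfl; exact norm_zero_aux⟩

noncomputable instance : NormedAddCommGroup (OrliczSpace Φ μ) :=
  NormedAddCommGroup.ofCore (normedSpaceCore Φ μ)

noncomputable instance : NormedSpace ℝ (OrliczSpace Φ μ) :=
  NormedSpace.ofCore (normedSpaceCore Φ μ)

end OrliczSpace

/-- `A` is an atom of the measure space `(X, m, ν)`. -/
def IsMeasureAtom (ν : Measure X) (A : Set X) : Prop :=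
  MeasurableSet A ∧ 0 < ν A ∧ ∀ F : Set X, MeasurableSet F → F ⊆ A → ν F = 0 ∨ ν F = ν A

/-- `𝒮` is a countable set of pairwise disjoint atoms of `(X, m, ν)` whose union has a complement
containing no atoms. -/
def IsAtomicDecomposition (ν : Measure X) (𝒮 : Set (Set X)) : Prop :=
  𝒮.Countable ∧ 𝒮.PairwiseDisjoint id ∧ (∀ A ∈ 𝒮, IsMeasureAtom ν A) ∧
    ∀ F : Set X, IsMeasureAtom ν F → ¬ F ⊆ (⋃₀ 𝒮)ᶜ

/-- `g = 0` a.e. on the complement of `⋃ 𝒮`, and `g` has a nonzero (a.e. constant) value on only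
finitely many members of `𝒮`. -/
def NonzeroOnlyOnFinitelyMany (ν : Measure X) (𝒮 : Set (Set X)) (g : X → ℝ≥0∞) : Prop :=
  (∀ᵐ x ∂ν, x ∈ (⋃₀ 𝒮)ᶜ → g x = 0) ∧
    {A ∈ 𝒮 | ∃ c : ℝ≥0∞, c ≠ 0 ∧ ∀ᵐ x ∂ν.restrict A, g x = c}.Finite

end Orlicz

section CondExp

variable {X : Type*}

/-- The conditional expectation `E^m f = E^m f⁺ - E^m f⁻` of a real-valued function, from the
conditional expectation of nonnegative functions. It is meaningful when `E^m |f|` is finite almost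
everywhere; unlike for `MeasureTheory.condExp`, the function need not be integrable on the whole
space. -/
noncomputable def condE {m₀ : MeasurableSpace X} (m : MeasurableSpace X) (μ : Measure[m₀] X) (f : X → ℝ) : X → ℝ := fun x =>
  (condLExp m μ (fun y => ENNReal.ofReal (f y)) x).toReal
    - (condLExp m μ (fun y => ENNReal.ofReal (-f y)) x).toReal

theorem measurable_condE {m₀ : MeasurableSpace X} (m : MeasurableSpace X) (μ : Measure[m₀] X)
    (f : X → ℝ) :
    Measurable[m] (condE m μ f) :=
  (measurable_condLExp m μ _).ennreal_toReal.sub (measurable_condLExp m μ _).ennreal_toReal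

/-- The multiplication conditional expectation operator `EM_u f = E^m (u f)`, with value a class of
`m`-measurable functions. -/
noncomputable def mce {m m₀ : MeasurableSpace X} (hm : m ≤ m₀) (μ : Measure[m₀] X) (u f : X →ₘ[μ] ℝ) :
    @AEEqFun X ℝ m _ (μ.trim hm) :=
  @AEEqFun.mk X m (μ.trim hm) ℝ _ (condE m μ fun x => u x * f x)
    (measurable_condE m μ _).stronglyMeasurable.aestronglyMeasurable

end CondExp

/-! Everything localises, because `EM_u` commutes with multiplication by indicators of 𝒜-measurable
sets (`mce_indicator`). The basic estimate is `setLIntegral_young_mce_le`: for S ∈ 𝒜, conditional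
Jensen and Ψ(xy) ≤ Φ(x) + Θ(y) give ∫_S Ψ(kc E(uf)) ≤ ∫ Φ(kf) + ∫_S Θ(cu). With S = X this is
boundedness. Along disjoint sets S it says more: Θ ∈ Δ₂ makes every Θ(cu) integrable, so the last
term tends to 0 however large c is.

Hence a closed range cannot contain, for each of infinitely many disjoint D_n ∈ 𝒜, a function that
is nonzero on D_n (`not_isClosed_range_of_disjoint`). Otherwise cut and normalise to get b_n in the
range, supported in D_n and of norm 1/2, and thin out until ∫_{D_n} Θ(n 4^(n+1) u) ≤ 1. Closedness
puts ∑ 4^-(n+1) b_n in the range, say equal to Th. Then b_n = 4^(n+1) Th on D_n, and the estimate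
gives ‖b_n‖ ≤ C/n, a contradiction.

Finite-dimensional subspaces are closed; every other implication produces or excludes such a
sequence. An infinite-dimensional range yields one, since a set that cannot be split carries at most
a line of functions (`exists_split_of_not_finiteDimensional_map`). Failure of (a) yields one, from
the nonatomic part or from infinitely many atoms, because u ≥ 0 is not a.e. zero on the pieces.
Conversely, under (a) and with Φ* vanishing only at 0, u vanishes off finitely many atoms; two
disjoint sets cannot both meet one atom in positive measure, so no such sequence exists and the
range is finite-dimensional. -/

/-- Iterating S ↦ S' gives a decreasing sequence; the pieces removed at successive steps are
disjoint. -/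
theorem exists_disjoint_seq_of_forall_split {X : Type*} {P Q : Set X → Prop}
    (h : ∀ S, P S → ∃ S' ⊆ S, P S' ∧ Q (S \ S')) {S : Set X} (hS : P S) :
    ∃ D : ℕ → Set X, Pairwise (Function.onFun Disjoint D) ∧ ∀ n, D n ⊆ S ∧ Q (D n) := by
  choose! next hsub hP hQ using h
  let s : ℕ → Set X := fun n => next^[n] S
  have hs1 : ∀ n, s (n + 1) = next (s n) := fun n => Function.iterate_succ_apply' next n S
  have hs : ∀ n, P (s n) := by
    intro n
    induction n with
    | zero => exact hS
    | succ n ih => rw [hs1]; exact hP _ ih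
  have hanti : Antitone s := antitone_nat_of_succ_le fun n => by
    rw [hs1]; exact hsub _ (hs n)
  refine ⟨fun n => s n \ s (n + 1), (pairwise_disjoint_on _).2 fun i j hij => ?_, fun n => ?_⟩
  · exact disjoint_sdiff_left.mono_right (sdiff_subset.trans (hanti hij))
  · refine ⟨sdiff_subset.trans (hanti (Nat.zero_le n)), ?_⟩
    have := hQ _ (hs n)
    rwa [← hs1] at this

/-! ### Subgradients and complements of Young functions. -/

namespace YoungFunction

theorem convexOn_toReal {Ψ : YoungFunction} (hΨ : Ψ.IsFinite) :
    ConvexOn ℝ univ fun x => (Ψ x).toReal := by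
  refine ⟨convex_univ, fun x _ y _ s t hs ht hst => ?_⟩
  have h := Ψ.apply_convex hs ht hst x y
  have h2 := ENNReal.toReal_mono (ENNReal.add_ne_top.2
    ⟨ENNReal.mul_ne_top ENNReal.ofReal_ne_top (hΨ x),
      ENNReal.mul_ne_top ENNReal.ofReal_ne_top (hΨ y)⟩) h
  rwa [ENNReal.toReal_add (ENNReal.mul_ne_top ENNReal.ofReal_ne_top (hΨ x))
    (ENNReal.mul_ne_top ENNReal.ofReal_ne_top (hΨ y)), ENNReal.toReal_mul, ENNReal.toReal_mul,
    ENNReal.toReal_ofReal hs, ENNReal.toReal_ofReal ht] at h2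

/-- The slope a is the right derivative at q. The supporting line is written with nonnegative terms
on both sides, so that it can be integrated in [0, ∞]. -/
theorem exists_subgradient {Ψ : YoungFunction} (hΨ : Ψ.IsFinite) {q : ℝ} (hq : 0 ≤ q) :
    ∃ a : ℝ, 0 ≤ a ∧ ∀ x, 0 ≤ x →
      Ψ q + ENNReal.ofReal (a * x) ≤ Ψ x + ENNReal.ofReal (a * q) := by
  rcases hq.eq_or_lt with rfl | hq
  · exact ⟨0, le_rfl, fun x _ => by simp [Ψ.zero']⟩
  have hc := convexOn_toReal hΨ
  set f : ℝ → ℝ := fun x => (Ψ x).toReal with hf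
  set a := derivWithin f (Ioi q) q with ha
  have hi : ∀ z : ℝ, z ∈ interior (univ : Set ℝ) := by simp
  have key : ∀ x, f q + a * (x - q) ≤ f x := by
    intro x
    rcases lt_trichotomy x q with h | rfl | h
    · have h1 := hc.slope_le_leftDeriv_of_mem_interior (mem_univ x) (hi q) h
      have h2 := hc.leftDeriv_le_rightDeriv_of_mem_interior (hi q)
      have h3 := h1.trans h2
      rw [slope_def_field, div_le_iff₀ (by linarith)] at h3
      linarith
    · simp
    · have h3 := hc.rightDeriv_le_slope_of_mem_interior (hi q) (mem_univ x) h
      rw [slope_def_field, le_div_iff₀ (by linarith)] at h3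
      linarith
  have ha0 : 0 ≤ a := by
    have h0 := key 0
    have h1 : f 0 = 0 := by simp [hf, Ψ.zero']
    have h2 : 0 ≤ f q := ENNReal.toReal_nonneg
    by_contra! h
    nlinarith
  refine ⟨a, ha0, fun x hx => ?_⟩
  rw [← ENNReal.ofReal_toReal (hΨ q), ← ENNReal.ofReal_toReal (hΨ x),
    ← ENNReal.ofReal_add ENNReal.toReal_nonneg (by positivity),
    ← ENNReal.ofReal_add ENNReal.toReal_nonneg (by positivity)]
  apply ENNReal.ofReal_le_ofReal
  have := key x
  simp only [hf] at this
  linarith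

theorem measurable_compl (Φ : YoungFunction) : Measurable Φ.compl := by
  have h : Monotone fun y : ℝ => ⨆ (x : ℝ) (_ : 0 ≤ x), (ENNReal.ofReal (x * y) - Φ x) := by
    intro y z hyz
    refine iSup₂_mono fun x hx => ?_
    gcongr
  exact h.measurable.comp measurable_norm

theorem compl_zero (Φ : YoungFunction) : Φ.compl 0 = 0 := by
  simp [YoungFunction.compl]

/-- Left continuity reduces the bound to countably many points, so that conditional Jensen needs
only one null set. -/
theorem le_of_forall_rat_lt (Ψ : YoungFunction) {x : ℝ} (hx : 0 < x) {b : ℝ≥0∞}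
    (h : ∀ q : ℚ, 0 ≤ (q : ℝ) → (q : ℝ) < x → Ψ q ≤ b) : Ψ x ≤ b := by
  refine le_of_tendsto (Ψ.leftCts' x hx) ?_
  filter_upwards [Ioo_mem_nhdsLT hx] with y hy
  obtain ⟨q, hq1, hq2⟩ := exists_rat_btwn hy.2
  refine (Ψ.mono_abs ?_).trans (h q (hy.1.le.trans hq1.le) hq2)
  rw [abs_of_pos hy.1, abs_of_pos (hy.1.trans hq1)]
  exact hq1.le

end YoungFunction

/-! ### Splitting sets, disjoint sequences and atoms. -/

section SingleMeasure

variable {X : Type*} {m : MeasurableSpace X} {ν : Measure X}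

/-- If no U splits S, each measurable U contains g(x) for almost every or almost no x ∈ S; a
countable separating family then isolates one value. -/
theorem ae_const_on_or_split {β : Type*} [MeasurableSpace β] [Nonempty β]
    [MeasurableSpace.CountablySeparated β] {S : Set X} (hS : MeasurableSet S) {g : X → β} :
    (∃ c, ∀ᵐ x ∂ν, x ∈ S → g x = c) ∨
      ∃ U, MeasurableSet U ∧ ν (S ∩ g ⁻¹' U) ≠ 0 ∧ ν (S \ g ⁻¹' U) ≠ 0 := by
  by_contra! h
  obtain ⟨h1, h2⟩ := h
  obtain ⟨c, hc⟩ := exists_eventuallyEq_const_of_forall_separating (l := ae (ν.restrict S))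
    (f := g) MeasurableSet (fun U hU => by
      by_cases hU0 : ν (S ∩ g ⁻¹' U) = 0
      · right
        rw [ae_restrict_iff' hS]
        refine measure_mono_null (fun x hx => ?_) hU0
        simpa using hx
      · left
        rw [ae_restrict_iff' hS]
        refine measure_mono_null (fun x hx => ?_) (h2 U hU hU0)
        simpa using hx)
  refine h1 c ?_
  filter_upwards [(ae_restrict_iff' hS).1 hc] with x hx
  simpa using hx

/-- Multiplication by the indicator function of a measurable set, as a linear map. -/
noncomputable def indicatorLin (ν : Measure X) (S : Set X) (hS : MeasurableSet S) :
    (X →ₘ[ν] ℝ) →ₗ[ℝ] (X →ₘ[ν] ℝ) where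
  toFun v := AEEqFun.mk (S.indicator v) (v.measurable.indicator hS).aestronglyMeasurable
  map_add' v w := by
    refine AEEqFun.ext ?_
    filter_upwards [AEEqFun.coeFn_mk (μ := ν) (S.indicator (v + w : X →ₘ[ν] ℝ))
        ((v + w).measurable.indicator hS).aestronglyMeasurable,
      AEEqFun.coeFn_mk (μ := ν) (S.indicator v) (v.measurable.indicator hS).aestronglyMeasurable,
      AEEqFun.coeFn_mk (μ := ν) (S.indicator w) (w.measurable.indicator hS).aestronglyMeasurable,
      AEEqFun.coeFn_add v w,
      AEEqFun.coeFn_add (AEEqFun.mk (μ := ν) (S.indicator v)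
        (v.measurable.indicator hS).aestronglyMeasurable) (AEEqFun.mk (S.indicator w)
        (w.measurable.indicator hS).aestronglyMeasurable)] with x h1 h2 h3 h4 h5
    rw [h1, h5, Pi.add_apply, h2, h3]
    by_cases hx : x ∈ S <;> simp [hx, h4]
  map_smul' c v := by
    refine AEEqFun.ext ?_
    filter_upwards [AEEqFun.coeFn_mk (μ := ν) (S.indicator (c • v : X →ₘ[ν] ℝ))
        ((c • v).measurable.indicator hS).aestronglyMeasurable,
      AEEqFun.coeFn_mk (μ := ν) (S.indicator v) (v.measurable.indicator hS).aestronglyMeasurable,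
      AEEqFun.coeFn_smul c v,
      AEEqFun.coeFn_smul c (AEEqFun.mk (μ := ν) (S.indicator v)
        (v.measurable.indicator hS).aestronglyMeasurable)] with x h1 h2 h4 h5
    rw [h1, RingHom.id_apply, h5, Pi.smul_apply, h2]
    by_cases hx : x ∈ S <;> simp [hx, h4]

theorem coeFn_indicatorLin {S : Set X} (hS : MeasurableSet S) (v : X →ₘ[ν] ℝ) :
    indicatorLin ν S hS v =ᵐ[ν] S.indicator v :=
  AEEqFun.coeFn_mk _ _

theorem ne_zero_of_indicatorLin {S : Set X} (hS : MeasurableSet S) {v : X →ₘ[ν] ℝ}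
    (hv : indicatorLin ν S hS v ≠ 0) : ¬ ∀ᵐ x ∂ν, x ∈ S → v x = 0 := by
  intro h
  apply hv
  refine AEEqFun.ext ?_
  filter_upwards [h, coeFn_indicatorLin hS v, AEEqFun.coeFn_zero (α := X) (β := ℝ) (μ := ν)]
    with x h1 h2 h3
  rw [h2, h3]
  by_cases hx : x ∈ S <;> simp [hx, h1]

/-- Guarantees that when S is cut in two, an infinite-dimensional restriction survives on one of the
halves. -/
theorem map_indicatorLin_le {S S' : Set X} (hS : MeasurableSet S) (hS' : MeasurableSet S')
    (hsub : S' ⊆ S) (V : Submodule ℝ (X →ₘ[ν] ℝ)) :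
    V.map (indicatorLin ν S hS) ≤
      V.map (indicatorLin ν S' hS') ⊔ V.map (indicatorLin ν (S \ S') (hS.diff hS')) := by
  rintro _ ⟨v, hv, rfl⟩
  have : indicatorLin ν S hS v
      = indicatorLin ν S' hS' v + indicatorLin ν (S \ S') (hS.diff hS') v := by
    refine AEEqFun.ext ?_
    filter_upwards [coeFn_indicatorLin hS v, coeFn_indicatorLin hS' v,
      coeFn_indicatorLin (hS.diff hS') v,
      AEEqFun.coeFn_add (indicatorLin ν S' hS' v) (indicatorLin ν (S \ S') (hS.diff hS') v)]
      with x h1 h2 h3 h4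
    rw [h1, h4, Pi.add_apply, h2, h3]
    by_cases hx' : x ∈ S'
    · simp [hx', hsub hx']
    · by_cases hx : x ∈ S <;> simp [hx, hx']
  rw [this]
  exact Submodule.add_mem_sup ⟨v, hv, rfl⟩ ⟨v, hv, rfl⟩

/-- If the restrictions to `S` of the elements of `V` span more than a line, then `S` splits into
two parts on each of which some element of `V` does not vanish. -/
theorem exists_split_of_not_finiteDimensional_map {S : Set X} (hS : MeasurableSet S)
    (V : Submodule ℝ (X →ₘ[ν] ℝ))
    (hV : ¬ FiniteDimensional ℝ (V.map (indicatorLin ν S hS))) :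
    ∃ S' ⊆ S, MeasurableSet S' ∧ (∃ v ∈ V, ¬ ∀ᵐ x ∂ν, x ∈ S' → v x = 0) ∧
      ∃ v ∈ V, ¬ ∀ᵐ x ∂ν, x ∈ S \ S' → v x = 0 := by
  by_contra hno'
  have hno : ∀ S' ⊆ S, MeasurableSet S' → (∃ v ∈ V, ¬ ∀ᵐ x ∂ν, x ∈ S' → v x = 0) →
      ∀ v ∈ V, ∀ᵐ x ∂ν, x ∈ S \ S' → v x = 0 := by
    intro S' h1 h2 h3 v hv
    by_contra h4
    exact hno' ⟨S', h1, h2, h3, v, hv, h4⟩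
  obtain ⟨v, hv, hv0⟩ : ∃ v ∈ V, indicatorLin ν S hS v ≠ 0 := by
    by_contra! h
    apply hV
    have : V.map (indicatorLin ν S hS) = ⊥ := by
      rw [eq_bot_iff]
      rintro _ ⟨v, hv, rfl⟩
      exact h v hv
    rw [this]
    infer_instance
  have hvS := ne_zero_of_indicatorLin hS hv0
  -- As v is nonzero on S ∩ N, `hno` makes all of V vanish on S \ N. Only the ratios w / v on S ∩ N
  -- remain to be studied.
  set N : Set X := {x | v x ≠ 0} with hN
  have hNm : MeasurableSet N := v.measurable (measurableSet_singleton (0 : ℝ)).compl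
  have hSN : ¬ ∀ᵐ x ∂ν, x ∈ S ∩ N → v x = 0 := by
    refine fun h => hvS ?_
    filter_upwards [h] with x hx hxS
    by_contra h0
    exact h0 (hx ⟨hxS, h0⟩)
  have hSN' := hno (S ∩ N) inter_subset_left (hS.inter hNm) ⟨v, hv, hSN⟩
  apply hV
  have : V.map (indicatorLin ν S hS) ≤ ℝ ∙ indicatorLin ν S hS v := by
    rintro _ ⟨w, hw, rfl⟩
    rw [Submodule.mem_span_singleton]
    have hgm : Measurable fun x => w x / v x := w.measurable.div v.measurable
    -- A constant ratio puts w on the line of v. Otherwise some U cuts S ∩ N into two non-null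
    -- parts, and v is nonzero on both, against `hno`.
    rcases ae_const_on_or_split (ν := ν) (hS.inter hNm) (g := fun x => w x / v x) with ⟨c, hc⟩ | ⟨U, hU, h1, h2⟩
    · refine ⟨c, AEEqFun.ext ?_⟩
      filter_upwards [hc, hSN' w hw, hSN' v hv, coeFn_indicatorLin hS v, coeFn_indicatorLin hS w,
        AEEqFun.coeFn_smul c (indicatorLin ν S hS v)] with x h1 h2 h2' h3 h4 h5
      rw [h4, h5, Pi.smul_apply, h3]
      by_cases hx : x ∈ S
      · by_cases hxN : x ∈ N
        · have := h1 ⟨hx, hxN⟩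
          rw [div_eq_iff hxN] at this
          simp [hx, this]
        · have hx' : x ∈ S \ (S ∩ N) := ⟨hx, fun h => hxN h.2⟩
          simp [hx, h2 hx', h2' hx']
      · simp [hx]
    · have hne : ∀ R ⊆ N, ν R ≠ 0 → ¬ ∀ᵐ x ∂ν, x ∈ R → v x = 0 := by
        intro R hR hR0 h
        apply hR0
        refine measure_mono_null (fun x hx => ?_) h
        simpa using ⟨hx, hR hx⟩
      have h3 := hno (S ∩ N ∩ (fun x => w x / v x) ⁻¹' U)
        (inter_subset_left.trans inter_subset_left)
        ((hS.inter hNm).inter (hgm hU)) ⟨v, hv, hne _ (fun x hx => hx.1.2) h1⟩ v hv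
      refine (hne _ (fun x hx => hx.1.2) h2 ?_).elim
      filter_upwards [h3] with x hx hx'
      exact hx ⟨hx'.1.1, fun h => hx'.2 h.2⟩
  exact Submodule.finiteDimensional_of_le this

theorem exists_disjoint_seq_of_not_finiteDimensional (V : Submodule ℝ (X →ₘ[ν] ℝ))
    (hV : ¬ FiniteDimensional ℝ V) :
    ∃ D : ℕ → Set X, Pairwise (Function.onFun Disjoint D) ∧ ∀ n, MeasurableSet (D n) ∧
      ∃ v ∈ V, ¬ ∀ᵐ x ∂ν, x ∈ D n → v x = 0 := by
  let P : Set X → Prop := fun S => ∃ hS : MeasurableSet S,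
    ¬ FiniteDimensional ℝ (V.map (indicatorLin ν S hS))
  let Q : Set X → Prop := fun S => MeasurableSet S ∧ ∃ v ∈ V, ¬ ∀ᵐ x ∂ν, x ∈ S → v x = 0
  have hsplit : ∀ S, P S → ∃ S' ⊆ S, P S' ∧ Q (S \ S') := by
    rintro S ⟨hS, hSV⟩
    obtain ⟨R, hRS, hR, h1, h2⟩ := exists_split_of_not_finiteDimensional_map hS V hSV
    -- Continue with a half on which V stays infinite-dimensional; the other half becomes a member
    -- of the sequence.
    by_cases hf : FiniteDimensional ℝ (V.map (indicatorLin ν R hR))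
    · refine ⟨S \ R, sdiff_subset, ⟨hS.diff hR, fun hf' => hSV ?_⟩, ?_⟩
      · exact Submodule.finiteDimensional_of_le (map_indicatorLin_le hS hR hRS V)
      · rw [sdiff_sdiff_cancel_left hRS]
        exact ⟨hR, h1⟩
    · exact ⟨R, hRS, ⟨hR, hf⟩, hS.diff hR, h2⟩
  have huniv : P univ := by
    refine ⟨MeasurableSet.univ, ?_⟩
    have : indicatorLin ν univ MeasurableSet.univ = LinearMap.id := by
      ext1 v
      refine AEEqFun.ext ?_
      filter_upwards [coeFn_indicatorLin MeasurableSet.univ v] with x hx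
      rw [hx]
      simp
    rw [this, Submodule.map_id]
    exact hV
  obtain ⟨D, hD, hDQ⟩ := exists_disjoint_seq_of_forall_split hsplit huniv
  exact ⟨D, hD, fun n => (hDQ n).2⟩

theorem exists_disjoint_seq_of_no_atoms {B S : Set X} (hB : ∀ F, IsMeasureAtom ν F → ¬ F ⊆ B)
    (hSB : S ⊆ B) (hS : MeasurableSet S) (hS0 : ν S ≠ 0) :
    ∃ D : ℕ → Set X, Pairwise (Function.onFun Disjoint D) ∧
      ∀ n, D n ⊆ S ∧ MeasurableSet (D n) ∧ ν (D n) ≠ 0 := by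
  refine exists_disjoint_seq_of_forall_split (P := fun R => R ⊆ B ∧ MeasurableSet R ∧ ν R ≠ 0)
    (Q := fun R => MeasurableSet R ∧ ν R ≠ 0) ?_ ⟨hSB, hS, hS0⟩
  rintro R ⟨hRB, hR, hR0⟩
  have hat : ¬ IsMeasureAtom ν R := fun h => hB R h hRB
  simp only [IsMeasureAtom, not_and, not_forall, not_or] at hat
  obtain ⟨F, hF, hFR, h1, h2⟩ := hat hR (pos_iff_ne_zero.2 hR0)
  refine ⟨F, hFR, ⟨hFR.trans hRB, hF, h1⟩, hR.diff hF, fun h => h2 ?_⟩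
  rw [← measure_inter_add_sdiff R hF, h, add_zero, inter_eq_self_of_subset_right hFR]

/-- An atom of infinite measure would meet every spanning set in a set of finite measure, hence in a
null set, and so be null. -/
theorem IsMeasureAtom.measure_lt_top [SigmaFinite ν] {A : Set X} (hA : IsMeasureAtom ν A) :
    ν A < ∞ := by
  by_contra h
  have hle : ν A ≠ 0 := hA.2.1.ne'
  apply hle
  rw [← inter_univ A, ← iUnion_spanningSets ν, inter_iUnion, measure_iUnion_null_iff]
  intro i
  have hlt : ν (A ∩ spanningSets ν i) < ∞ :=
    (measure_mono inter_subset_right).trans_lt (measure_spanningSets_lt_top ν i)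
  rcases hA.2.2 _ (hA.1.inter (measurableSet_spanningSets ν i)) inter_subset_left with h1 | h1
  · exact h1
  · exact (h (h1 ▸ hlt)).elim

theorem IsMeasureAtom.ae_const [SigmaFinite ν] {A : Set X} (hA : IsMeasureAtom ν A)
    {g : X → ℝ≥0∞} (hg : Measurable g) : ∃ c, ∀ᵐ x ∂ν, x ∈ A → g x = c := by
  rcases ae_const_on_or_split (ν := ν) hA.1 (g := g) with h | ⟨U, hU, h1, h2⟩
  · exact h
  · rcases hA.2.2 _ (hA.1.inter (hg hU)) inter_subset_left with h | h
    · exact (h1 h).elim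
    · have h3 := measure_inter_add_sdiff (μ := ν) A (hg hU)
      rw [h] at h3
      exact (h2 ((ENNReal.add_right_inj hA.measure_lt_top.ne).1 (h3.trans (add_zero _).symm))).elim

/-- D ∩ A carries the whole finite measure of A, which leaves nothing for a set disjoint from D. -/
theorem IsMeasureAtom.not_disjoint [SigmaFinite ν] {A D D' : Set X} (hA : IsMeasureAtom ν A)
    (hD : MeasurableSet D) (h : ν (D ∩ A) ≠ 0) (h' : ν (D' ∩ A) ≠ 0) :
    ¬ Disjoint D D' := by
  intro hdis
  have e := (hA.2.2 _ (hD.inter hA.1) inter_subset_right).resolve_left h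
  apply h'
  have h3 := measure_inter_add_sdiff (μ := ν) A hD
  rw [inter_comm, e] at h3
  refine measure_mono_null (t := A \ D) (fun x hx => ⟨hx.2, fun hxD => ?_⟩)
    ((ENNReal.add_right_inj hA.measure_lt_top.ne).1 (h3.trans (add_zero _).symm))
  exact (disjoint_left.1 hdis hxD hx.1)

end SingleMeasure

/-! ### Series with disjoint supports, and integrability from Δ₂. -/

section SingleMeasure

variable {X : Type*} {m : MeasurableSpace X} {ν : Measure X} {Ψ : YoungFunction}

namespace OrliczSpace

theorem coeFn_sum_smul (b : ℕ → OrliczSpace Ψ ν) (w : ℕ → ℝ) (N : ℕ) :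
    ∀ᵐ x ∂ν, (∑ j ∈ Finset.range N, w j • b j).toAEEqFun x
      = ∑ j ∈ Finset.range N, w j * (b j).toAEEqFun x := by
  induction N with
  | zero =>
    filter_upwards [AEEqFun.coeFn_zero (α := X) (β := ℝ) (μ := ν)] with x hx
    simp only [Finset.range_zero, Finset.sum_empty]
    exact hx
  | succ N ih =>
    simp only [Finset.sum_range_succ, coe_add, coe_smul]
    filter_upwards [ih, AEEqFun.coeFn_smul (w N) (b N).toAEEqFun,
      AEEqFun.coeFn_add (∑ j ∈ Finset.range N, w j • b j).toAEEqFun (w N • (b N).toAEEqFun)]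
      with x h1 h2 h3
    rw [h3, Pi.add_apply, h1, h2, Pi.smul_apply, smul_eq_mul]

/-- Builds the sum of a disjointly supported series pointwise, so that completeness of the Orlicz
space is not needed. -/
theorem exists_glued {D : ℕ → Set X} (hD : ∀ n, MeasurableSet (D n))
    (hdis : Pairwise (Function.onFun Disjoint D)) (b : ℕ → X →ₘ[ν] ℝ) (w : ℕ → ℝ) :
    ∃ G : X →ₘ[ν] ℝ, (∀ᵐ x ∂ν, x ∉ ⋃ n, D n → G x = 0) ∧
      ∀ n, ∀ᵐ x ∂ν, x ∈ D n → G x = w n * b n x := by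
  obtain ⟨f, hf, hfD⟩ := exists_measurable_piecewise D hD (fun n x => w n * b n x)
    (fun n => (b n).measurable.const_mul (w n)) (fun i j hij x hx =>
      (disjoint_left.1 (hdis hij) hx.1 hx.2).elim)
  have hG : Measurable ((⋃ n, D n).indicator f) := hf.indicator (MeasurableSet.iUnion hD)
  refine ⟨AEEqFun.mk _ hG.aestronglyMeasurable, ?_, fun n => ?_⟩
  · filter_upwards [AEEqFun.coeFn_mk (μ := ν) _ hG.aestronglyMeasurable] with x hx h
    rw [hx, indicator_of_notMem h]
  · filter_upwards [AEEqFun.coeFn_mk (μ := ν) _ hG.aestronglyMeasurable] with x hx h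
    rw [hx, indicator_of_mem (mem_iUnion_of_mem n h), hfD n h]

theorem exists_mem_of_isClosed_of_disjoint_support (V : Submodule ℝ (OrliczSpace Ψ ν))
    (hV : IsClosed (V : Set (OrliczSpace Ψ ν))) {D : ℕ → Set X} (hD : ∀ n, MeasurableSet (D n))
    (hdis : Pairwise (Function.onFun Disjoint D)) {b : ℕ → OrliczSpace Ψ ν} (hbV : ∀ n, b n ∈ V)
    (hb1 : ∀ n, ‖b n‖ < 1) (hsupp : ∀ n, ∀ᵐ x ∂ν, x ∉ D n → (b n).toAEEqFun x = 0) :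
    ∃ g ∈ V, ∀ n, ∀ᵐ x ∂ν, x ∈ D n →
      g.toAEEqFun x = (1 / 4 : ℝ) ^ (n + 1) * (b n).toAEEqFun x := by
  set w : ℕ → ℝ := fun n => (1 / 4 : ℝ) ^ (n + 1) with hw
  obtain ⟨G, hG0, hGD⟩ := exists_glued (ν := ν) hD hdis (fun n => (b n).toAEEqFun) w
  set s : ℕ → OrliczSpace Ψ ν := fun N => ∑ j ∈ Finset.range N, w j • b j with hs
  have hbi : ∀ n, ∫⁻ x, Ψ ((b n).toAEEqFun x) ∂ν ≤ 1 := fun n => by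
    simpa using lintegral_le_one_of_norm_lt (hb1 n)
  have hmeas : ∀ n, Measurable fun x => Ψ ((b n).toAEEqFun x) := fun n =>
    Ψ.measurable.comp (b n).toAEEqFun.measurable
  -- The difference lives on the D_n with n ≥ N. There 2^N 4^-(n+1) ≤ 2^-(n+1), so convexity bounds
  -- the integrand by 2^-(n+1) Ψ(b_n), and the weights sum to 1. This gives ‖G - s_N‖ ≤ 2^-N.
  have key : ∀ N, ∫⁻ x, Ψ (2 ^ N * (G x - (s N).toAEEqFun x)) ∂ν ≤ 1 := by
    intro N
    calc ∫⁻ x, Ψ (2 ^ N * (G x - (s N).toAEEqFun x)) ∂ν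
        ≤ ∫⁻ x, ∑' n, (2⁻¹ : ℝ≥0∞) ^ (n + 1) * Ψ ((b n).toAEEqFun x) ∂ν := by
          apply lintegral_mono_ae
          filter_upwards [hG0, ae_all_iff.2 hGD, ae_all_iff.2 hsupp, coeFn_sum_smul b w N]
            with x h0 h1 h2 h3
          rw [h3]
          by_cases hx : x ∈ ⋃ n, D n
          · obtain ⟨n, hn⟩ := mem_iUnion.1 hx
            have h4 : ∀ j, j ≠ n → (b j).toAEEqFun x = 0 := fun j hj =>
              h2 j fun hxj => disjoint_left.1 (hdis hj) hxj hn
            have h5 : ∑ j ∈ Finset.range N, w j * (b j).toAEEqFun x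
                = if n < N then w n * (b n).toAEEqFun x else 0 := by
              split_ifs with hnN
              · rw [Finset.sum_eq_single n (fun j _ hj => by rw [h4 j hj, mul_zero])
                  (fun h => (h (Finset.mem_range.2 hnN)).elim)]
              · refine Finset.sum_eq_zero fun j hj => ?_
                rw [h4 j (by rintro rfl; exact hnN (Finset.mem_range.1 hj)), mul_zero]
            rw [h5, h1 n hn]
            refine le_trans ?_ (ENNReal.le_tsum n)
            split_ifs with hnN
            · simp [Ψ.zero']
            · have hle : (2 : ℝ) ^ N * (1 / 4) ^ (n + 1) ≤ (1 / 2) ^ (n + 1) := by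
                have e : (1 / 4 : ℝ) ^ (n + 1) = (1 / 2) ^ (n + 1) * (1 / 2) ^ (n + 1) := by
                  rw [← mul_pow]; norm_num
                have e2 : (2 : ℝ) ^ N * (1 / 2) ^ (n + 1) ≤ 1 := by
                  calc (2 : ℝ) ^ N * (1 / 2) ^ (n + 1) ≤ 2 ^ (n + 1) * (1 / 2) ^ (n + 1) := by
                        gcongr
                        · norm_num
                        · omega
                    _ = 1 := by rw [← mul_pow]; norm_num
                rw [e, ← mul_assoc]
                exact mul_le_of_le_one_left (by positivity) e2
              have h6 : Ψ (2 ^ N * (w n * (b n).toAEEqFun x - 0))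
                  ≤ Ψ ((1 / 2) ^ (n + 1) * (b n).toAEEqFun x) := by
                apply Ψ.mono_abs
                rw [sub_zero, ← mul_assoc, abs_mul (2 ^ N * w n), abs_mul ((1 / 2) ^ (n + 1))]
                refine mul_le_mul_of_nonneg_right ?_ (abs_nonneg _)
                rw [abs_of_nonneg (by positivity), abs_of_nonneg (by positivity)]
                exact hle
              refine h6.trans ((Ψ.apply_mul_le (by positivity)
                (pow_le_one₀ (by norm_num) (by norm_num)) _).trans_eq ?_)
              congr 1
              rw [ENNReal.ofReal_pow (by norm_num)]
              congr 1
              rw [one_div, ENNReal.ofReal_inv_of_pos two_pos]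
              simp
          · have h4 : ∀ j, (b j).toAEEqFun x = 0 := fun j =>
              h2 j fun hxj => hx (mem_iUnion_of_mem j hxj)
            simp [h0 hx, h4, Ψ.zero']
      _ = ∑' n, (2⁻¹ : ℝ≥0∞) ^ (n + 1) * ∫⁻ x, Ψ ((b n).toAEEqFun x) ∂ν := by
          rw [lintegral_tsum fun n => ((hmeas n).const_mul _).aemeasurable]
          simp_rw [lintegral_const_mul _ (hmeas _)]
      _ ≤ ∑' n, (2⁻¹ : ℝ≥0∞) ^ (n + 1) * 1 := by
          gcongr with n
          exact hbi n
      _ = 1 := by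
          simp only [mul_one]
          rw [ENNReal.tsum_geometric_add_one, ENNReal.one_sub_inv_two, inv_inv]
          exact ENNReal.inv_mul_cancel two_ne_zero ENNReal.ofNat_ne_top
  -- Since s_0 = 0, the case N = 0 of `key` is membership of G.
  have hGmem : G ∈ orliczSubmodule Ψ ν := by
    refine ⟨1, one_pos, lt_of_le_of_lt (le_of_eq ?_) ((key 0).trans_lt ENNReal.one_lt_top)⟩
    apply lintegral_congr_ae
    filter_upwards [coeFn_sum_smul b w 0] with x hx
    simp only [hs]
    rw [hx]
    simp
  let g : OrliczSpace Ψ ν := ⟨G, hGmem⟩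
  have hlim : Tendsto s atTop (𝓝 g) := by
    rw [tendsto_iff_norm_sub_tendsto_zero]
    refine squeeze_zero (fun _ => norm_nonneg _) (fun N => ?_)
      (tendsto_pow_atTop_nhds_zero_of_lt_one (r := (1 / 2 : ℝ)) (by norm_num) (by norm_num))
    rw [norm_sub_rev]
    apply norm_le_of_lintegral_le (by positivity)
    refine le_of_eq_of_le ?_ (key N)
    apply lintegral_congr_ae
    have e : (g - s N).toAEEqFun = G - (s N).toAEEqFun := rfl
    rw [e]
    filter_upwards [AEEqFun.coeFn_sub G (s N).toAEEqFun] with x hx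
    rw [hx, Pi.sub_apply]
    congr 1
    rw [div_eq_mul_inv, ← inv_pow, one_div, inv_inv, mul_comm]
  refine ⟨g, hV.mem_of_tendsto hlim (Eventually.of_forall fun N => ?_), hGD⟩
  exact V.sum_mem fun j _ => V.smul_mem _ (hbV j)

end OrliczSpace

/-- Iterating Δ₂ turns one admissible scale k into 2^n k, at the price of a factor K^n. -/
theorem YoungFunction.DeltaTwo.lintegral_lt_top {Θ : YoungFunction} (h : Θ.DeltaTwo)
    {u : X →ₘ[ν] ℝ} (hu : u ∈ orliczSubmodule Θ ν) (c : ℝ) : ∫⁻ x, Θ (c * u x) ∂ν < ∞ := by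
  obtain ⟨K, -, hK⟩ := h
  obtain ⟨k, hk, hku⟩ := hu
  have hpow : ∀ n : ℕ, ∀ x, Θ (2 ^ n * x) ≤ (K : ℝ≥0∞) ^ n * Θ x := by
    intro n x
    induction n with
    | zero => simp
    | succ n ih =>
      calc Θ (2 ^ (n + 1) * x) = Θ (2 * |2 ^ n * x|) := by
            rw [← Θ.apply_abs (2 ^ (n + 1) * x)]
            congr 1
            rw [pow_succ', mul_assoc, abs_mul, abs_two]
        _ ≤ K * Θ |2 ^ n * x| := hK _ (abs_nonneg _)
        _ ≤ K * (K ^ n * Θ x) := by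
            rw [Θ.apply_abs]
            gcongr
        _ = (K : ℝ≥0∞) ^ (n + 1) * Θ x := by rw [pow_succ', mul_assoc]
  obtain ⟨n, hn⟩ := pow_unbounded_of_one_lt (|c| / k) (one_lt_two : (1 : ℝ) < 2)
  rw [div_lt_iff₀ hk] at hn
  calc ∫⁻ x, Θ (c * u x) ∂ν ≤ ∫⁻ x, (K : ℝ≥0∞) ^ n * Θ (k * u x) ∂ν := by
        refine lintegral_mono fun x => (Θ.mono_abs ?_).trans (hpow n (k * u x))
        rw [← mul_assoc, abs_mul, abs_mul _ (u x)]
        refine mul_le_mul_of_nonneg_right ?_ (abs_nonneg _)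
        rw [abs_of_pos (a := 2 ^ n * k) (by positivity)]
        exact hn.le
    _ = (K : ℝ≥0∞) ^ n * ∫⁻ x, Θ (k * u x) ∂ν :=
        lintegral_const_mul _ (Θ.measurable.comp (u.measurable.const_mul k))
    _ < ∞ := ENNReal.mul_lt_top (by simp) hku

/-- For fixed n the integrals of F n over the disjoint D k are summable in k, hence eventually at
most 1. -/
theorem exists_subseq_setLIntegral_le_one {F : ℕ → X → ℝ≥0∞}
    (hF : ∀ n, ∫⁻ x, F n x ∂ν < ∞) {D : ℕ → Set X} (hD : ∀ n, MeasurableSet (D n))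
    (hdis : Pairwise (Function.onFun Disjoint D)) :
    ∃ φ : ℕ → ℕ, StrictMono φ ∧ ∀ n, ∫⁻ x in D (φ n), F n x ∂ν ≤ 1 := by
  refine extraction_forall_of_eventually (P := fun n k => ∫⁻ x in D k, F n x ∂ν ≤ 1) ?_
  intro n
  have h : ∑' k, ∫⁻ x in D k, F n x ∂ν ≠ ∞ := by
    rw [← lintegral_iUnion hD hdis]
    exact ((setLIntegral_le_lintegral _ _).trans_lt (hF n)).ne
  have h2 := (ENNReal.tendsto_cofinite_zero_of_tsum_ne_top h)
  rw [Nat.cofinite_eq_atTop] at h2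
  exact (h2.eventually (gt_mem_nhds one_pos)).mono fun k hk => hk.le

end SingleMeasure

/-! ### Conditional expectation of signed functions and conditional Jensen. -/

section CondExp

variable {X : Type*} {m m₀ : MeasurableSpace X}

theorem ae_trim_of_ae (hm : m ≤ m₀) {μ : Measure[m₀] X} {p : X → Prop}
    (hp : MeasurableSet[m] {x | p x}) (h : ∀ᵐ x ∂μ, p x) : ∀ᵐ x ∂(μ.trim hm), p x := by
  rw [ae_iff] at h ⊢
  have hp' : MeasurableSet[m] {x | ¬ p x} := MeasurableSet.compl (m := m) hp
  rw [trim_measurableSet_eq hm hp']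
  exact h

theorem condLExp_indicator (hm : m ≤ m₀) (μ : Measure[m₀] X) [SigmaFinite (μ.trim hm)]
    {S : Set X} (hS : MeasurableSet[m] S) (f : X → ℝ≥0∞) :
    condLExp m μ (S.indicator f) =ᵐ[μ] S.indicator (condLExp m μ f) := by
  symm
  refine ae_eq_condLExp hm μ _ (Measurable.indicator (measurable_condLExp m μ f) hS) ?_
  intro s hs
  rw [setLIntegral_indicator (hm S hS), setLIntegral_indicator (hm S hS)]
  exact setLIntegral_condLExp hm μ f (MeasurableSet.inter (m := m) hS hs)

/-- Both nonnegative functions have the same integral over S. -/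
theorem condLExp_eq_zero_on_iff (hm : m ≤ m₀) (μ : Measure[m₀] X) [SigmaFinite (μ.trim hm)]
    {S : Set X} (hS : MeasurableSet[m] S) {f : X → ℝ≥0∞}
    (hf : Measurable f) :
    (∀ᵐ x ∂μ, x ∈ S → condLExp m μ f x = 0) ↔ ∀ᵐ x ∂μ, x ∈ S → f x = 0 := by
  have h1 := lintegral_eq_zero_iff (μ := μ.restrict S) (measurable_condLExp' m μ f)
  have h2 := lintegral_eq_zero_iff (μ := μ.restrict S) hf
  rw [setLIntegral_condLExp hm μ f hS, h2, EventuallyEq, EventuallyEq,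
    ae_restrict_iff' (hm S hS), ae_restrict_iff' (hm S hS)] at h1
  exact h1.symm

theorem condE_indicator (hm : m ≤ m₀) (μ : Measure[m₀] X) [SigmaFinite (μ.trim hm)]
    {S : Set X} (hS : MeasurableSet[m] S) (f : X → ℝ) :
    condE m μ (S.indicator f) =ᵐ[μ] S.indicator (condE m μ f) := by
  have e1 : (fun y => ENNReal.ofReal (S.indicator f y))
      = S.indicator fun y => ENNReal.ofReal (f y) := by
    funext y
    by_cases hy : y ∈ S <;> simp [hy]
  have e2 : (fun y => ENNReal.ofReal (-S.indicator f y))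
      = S.indicator fun y => ENNReal.ofReal (-f y) := by
    funext y
    by_cases hy : y ∈ S <;> simp [hy]
  filter_upwards [condLExp_indicator hm μ hS fun y => ENNReal.ofReal (f y),
    condLExp_indicator hm μ hS fun y => ENNReal.ofReal (-f y)] with x h1 h2
  simp only [condE]
  rw [e1, e2, h1, h2]
  by_cases hx : x ∈ S <;> simp [hx, condE]

theorem condE_congr_ae {μ : Measure[m₀] X} {f g : X → ℝ} (h : f =ᵐ[μ] g) :
    condE m μ f =ᵐ[μ] condE m μ g := by
  have h1 : condLExp m μ (fun y => ENNReal.ofReal (f y))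
      =ᵐ[μ] condLExp m μ fun y => ENNReal.ofReal (g y) :=
    condLExp_congr_ae (h.fun_comp ENNReal.ofReal)
  have h2 : condLExp m μ (fun y => ENNReal.ofReal (-f y))
      =ᵐ[μ] condLExp m μ fun y => ENNReal.ofReal (-g y) :=
    condLExp_congr_ae (h.fun_comp fun t => ENNReal.ofReal (-t))
  filter_upwards [h1, h2] with x h1 h2
  simp only [condE, h1, h2]

theorem condE_const_mul_of_nonneg {μ : Measure[m₀] X} {c : ℝ} (hc : 0 ≤ c) (f : X → ℝ) :
    condE m μ (fun y => c * f y) =ᵐ[μ] fun x => c * condE m μ f x := by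
  have e1 : (fun y => ENNReal.ofReal (c * f y))
      = ENNReal.ofReal c • fun y => ENNReal.ofReal (f y) := by
    funext y
    simp [ENNReal.ofReal_mul hc]
  have e2 : (fun y => ENNReal.ofReal (-(c * f y)))
      = ENNReal.ofReal c • fun y => ENNReal.ofReal (-f y) := by
    funext y
    rw [← mul_neg, ENNReal.ofReal_mul hc]
    simp
  filter_upwards [condLExp_smul' (mΩ := m) (P := μ) (fun y => ENNReal.ofReal (f y))
      (ENNReal.ofReal_ne_top (r := c)),
    condLExp_smul' (mΩ := m) (P := μ) (fun y => ENNReal.ofReal (-f y))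
      (ENNReal.ofReal_ne_top (r := c))] with x h1 h2
  simp only [condE]
  rw [e1, e2, h1, h2]
  simp [ENNReal.toReal_ofReal hc, mul_sub]

theorem condE_neg (μ : Measure[m₀] X) (f : X → ℝ) (x : X) :
    condE m μ (fun y => -f y) x = -condE m μ f x := by
  simp [condE]

theorem condE_const_mul {μ : Measure[m₀] X} (c : ℝ) (f : X → ℝ) :
    condE m μ (fun y => c * f y) =ᵐ[μ] fun x => c * condE m μ f x := by
  rcases le_total 0 c with hc | hc
  · exact condE_const_mul_of_nonneg hc f
  · filter_upwards [condE_const_mul_of_nonneg (m := m) (μ := μ) (neg_nonneg.2 hc) f] with x hx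
    have e : (fun y => c * f y) = fun y => -(-c * f y) := by
      funext y
      ring
    rw [e, condE_neg, hx]
    ring

theorem condLExp_ofReal_le_abs (μ : Measure[m₀] X) (f : X → ℝ) :
    ∀ᵐ x ∂μ, condLExp m μ (fun y => ENNReal.ofReal (f y)) x
        ≤ condLExp m μ (fun y => ENNReal.ofReal |f y|) x ∧
      condLExp m μ (fun y => ENNReal.ofReal (-f y)) x
        ≤ condLExp m μ (fun y => ENNReal.ofReal |f y|) x := by
  filter_upwards [condLExp_mono (mΩ := m) (P := μ) (X := fun y => ENNReal.ofReal (f y))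
      (Y := fun y => ENNReal.ofReal |f y|)
      (Eventually.of_forall fun y => ENNReal.ofReal_le_ofReal (le_abs_self _)),
    condLExp_mono (mΩ := m) (P := μ) (X := fun y => ENNReal.ofReal (-f y))
      (Y := fun y => ENNReal.ofReal |f y|)
      (Eventually.of_forall fun y => ENNReal.ofReal_le_ofReal (neg_le_abs _))] with x h1 h2
  exact ⟨h1, h2⟩

theorem abs_condE_le {μ : Measure[m₀] X} {f : X → ℝ}
    (hf : ∀ᵐ x ∂μ, condLExp m μ (fun y => ENNReal.ofReal |f y|) x < ∞) :
    ∀ᵐ x ∂μ, |condE m μ f x| ≤ (condLExp m μ (fun y => ENNReal.ofReal |f y|) x).toReal := by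
  filter_upwards [hf, condLExp_ofReal_le_abs μ f] with x h0 h
  have h1 := ENNReal.toReal_mono h0.ne h.1
  have h2 := ENNReal.toReal_mono h0.ne h.2
  have h3 : 0 ≤ (condLExp m μ (fun y => ENNReal.ofReal (f y)) x).toReal := ENNReal.toReal_nonneg
  have h4 : 0 ≤ (condLExp m μ (fun y => ENNReal.ofReal (-f y)) x).toReal := ENNReal.toReal_nonneg
  rw [condE, abs_le]
  constructor <;> linarith

theorem ofReal_add_add_ofReal_neg (a b : ℝ) :
    ENNReal.ofReal (a + b) + (ENNReal.ofReal (-a) + ENNReal.ofReal (-b))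
      = ENNReal.ofReal (-(a + b)) + (ENNReal.ofReal a + ENNReal.ofReal b) := by
  simp only [ENNReal.ofReal, ← ENNReal.coe_add]
  congr 1
  ext
  simp only [NNReal.coe_add, Real.coe_toNNReal']
  have h (t : ℝ) : max t 0 = t + max (-t) 0 := by
    rcases le_total 0 t with h | h
    · rw [max_eq_left h, max_eq_right (by linarith), add_zero]
    · rw [max_eq_right h, max_eq_left (by linarith), add_neg_cancel]
  rw [h (a + b), h a, h b]
  ring

/-- Additivity is applied in [0, ∞] to (f+g)⁺ + f⁻ + g⁻ = (f+g)⁻ + f⁺ + g⁺; the six conditional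
expectations are a.e. finite, so the terms can then be moved across. -/
theorem condE_add {μ : Measure[m₀] X} {f g : X → ℝ} (hfm : Measurable f) (hgm : Measurable g)
    (hf : ∀ᵐ x ∂μ, condLExp m μ (fun y => ENNReal.ofReal |f y|) x < ∞)
    (hg : ∀ᵐ x ∂μ, condLExp m μ (fun y => ENNReal.ofReal |g y|) x < ∞) :
    condE m μ (fun y => f y + g y) =ᵐ[μ] fun x => condE m μ f x + condE m μ g x := by
  set p : (X → ℝ) → X → ℝ≥0∞ := fun k y => ENNReal.ofReal (k y) with hp
  set n : (X → ℝ) → X → ℝ≥0∞ := fun k y => ENNReal.ofReal (-k y) with hn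
  set s : X → ℝ := fun y => f y + g y with hs
  have hpm : ∀ {k : X → ℝ}, Measurable k → Measurable (p k) := fun hk => hk.ennreal_ofReal
  have hnm : ∀ {k : X → ℝ}, Measurable k → Measurable (n k) := fun hk => hk.neg.ennreal_ofReal
  have hsm : Measurable s := hfm.add hgm
  have e : p s + (n f + n g) = n s + (p f + p g) := by
    funext y
    exact ofReal_add_add_ofReal_neg _ _
  have hs_le : ∀ᵐ x ∂μ, condLExp m μ (fun y => ENNReal.ofReal |s y|) x
      ≤ condLExp m μ ((fun y => ENNReal.ofReal |f y|) + fun y => ENNReal.ofReal |g y|) x := by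
    refine condLExp_mono (Eventually.of_forall fun y => ?_)
    simp only [Pi.add_apply]
    rw [← ENNReal.ofReal_add (abs_nonneg _) (abs_nonneg _)]
    exact ENNReal.ofReal_le_ofReal (abs_add_le _ _)
  filter_upwards [hf, hg, condLExp_ofReal_le_abs μ f, condLExp_ofReal_le_abs μ g,
    condLExp_ofReal_le_abs μ s, hs_le,
    condLExp_add_left (mΩ := m) (P := μ) (X := fun y => ENNReal.ofReal |f y|)
      (fun y => ENNReal.ofReal |g y|) (hpm (measurable_norm.comp hfm)).aemeasurable,
    condLExp_add_left (mΩ := m) (P := μ) (X := p s) (n f + n g) (hpm hsm).aemeasurable,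
    condLExp_add_left (mΩ := m) (P := μ) (X := n s) (p f + p g) (hnm hsm).aemeasurable,
    condLExp_add_left (mΩ := m) (P := μ) (X := p f) (p g) (hpm hfm).aemeasurable,
    condLExp_add_left (mΩ := m) (P := μ) (X := n f) (n g) (hnm hfm).aemeasurable]
    with x h1 h2 h3 h4 h5 h6 h7 h8 h9 h10 h11
  rw [h7, Pi.add_apply] at h6
  have hs1 := h6.trans_lt (ENNReal.add_lt_top.2 ⟨h1, h2⟩)
  have hpf := (h3.1.trans_lt h1).ne
  have hnf := (h3.2.trans_lt h1).ne
  have hpg := (h4.1.trans_lt h2).ne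
  have hng := (h4.2.trans_lt h2).ne
  have hps := (h5.1.trans_lt hs1).ne
  have hns := (h5.2.trans_lt hs1).ne
  rw [e, h9, Pi.add_apply, Pi.add_apply, h10, h11, Pi.add_apply, Pi.add_apply] at h8
  have h12 := congrArg ENNReal.toReal h8
  rw [ENNReal.toReal_add hns (ENNReal.add_ne_top.2 ⟨hpf, hpg⟩), ENNReal.toReal_add hpf hpg,
    ENNReal.toReal_add hps (ENNReal.add_ne_top.2 ⟨hnf, hng⟩), ENNReal.toReal_add hnf hng] at h12
  simp only [condE]
  linarith

theorem condLExp_subgradient_le (hm : m ≤ m₀) (μ : Measure[m₀] X) [SigmaFinite (μ.trim hm)]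
    {Ψ : YoungFunction} {g : X → ℝ} (hg : Measurable g) {q a : ℝ}
    (h : ∀ x, 0 ≤ x → Ψ q + ENNReal.ofReal (a * x) ≤ Ψ x + ENNReal.ofReal (a * q))
    (ha : 0 ≤ a) :
    ∀ᵐ x ∂μ, Ψ q + ENNReal.ofReal a * condLExp m μ (fun y => ENNReal.ofReal |g y|) x
      ≤ condLExp m μ (fun y => Ψ (g y)) x + ENNReal.ofReal (a * q) := by
  have hmono : ∀ᵐ x ∂μ, condLExp m μ ((fun _ => Ψ q) +
      ENNReal.ofReal a • fun y => ENNReal.ofReal |g y|) x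
      ≤ condLExp m μ ((fun y => Ψ (g y)) + fun _ => ENNReal.ofReal (a * q)) x := by
    refine condLExp_mono (Eventually.of_forall fun y => ?_)
    have := h |g y| (abs_nonneg _)
    rw [Ψ.apply_abs, ENNReal.ofReal_mul ha] at this
    simpa using this
  filter_upwards [hmono,
    condLExp_add_left (mΩ := m) (P := μ) (X := fun _ => Ψ q)
      (ENNReal.ofReal a • fun y => ENNReal.ofReal |g y|) aemeasurable_const,
    condLExp_add_left (mΩ := m) (P := μ) (X := fun y => Ψ (g y))
      (fun _ => ENNReal.ofReal (a * q)) (Ψ.measurable.comp hg).aemeasurable,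
    condLExp_smul' (mΩ := m) (P := μ) (fun y => ENNReal.ofReal |g y|)
      (ENNReal.ofReal_ne_top (r := a))] with x h1 h2 h3 h4
  rw [h2, h3, Pi.add_apply, Pi.add_apply, h4, condLExp_const hm, condLExp_const hm] at h1
  exact h1

theorem condLExp_abs_lt_top (hm : m ≤ m₀) (μ : Measure[m₀] X) [SigmaFinite (μ.trim hm)]
    {Ψ : YoungFunction} (hΨ : Ψ.IsFinite) {g : X → ℝ}
    (hg : Measurable g) (h : ∀ᵐ x ∂μ, condLExp m μ (fun y => Ψ (g y)) x < ∞) :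
    ∀ᵐ x ∂μ, condLExp m μ (fun y => ENNReal.ofReal |g y|) x < ∞ := by
  obtain ⟨q, hq, hq0⟩ := Ψ.exists_ne_zero'
  obtain ⟨a, ha, hsub⟩ := Ψ.exists_subgradient hΨ hq.le
  -- With slope 0, the supporting line at q evaluated at x = 0 would give Ψ q ≤ 0. A positive slope
  -- bounds |g| by an affine function of Ψ(g).
  have ha0 : ENNReal.ofReal a ≠ 0 := by
    intro h0
    have h1 := hsub 0 le_rfl
    rw [ENNReal.ofReal_mul ha, ENNReal.ofReal_mul ha, h0, Ψ.zero'] at h1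
    simp [hq0] at h1
  filter_upwards [h, condLExp_subgradient_le hm μ hg hsub ha] with x h1 h2
  have h3 := (le_add_self.trans h2).trans_lt (ENNReal.add_lt_top.2 ⟨h1, ENNReal.ofReal_lt_top⟩)
  by_contra h4
  rw [not_lt_top_iff.1 h4, ENNReal.mul_top ha0] at h3
  exact lt_irrefl _ h3

/-- Conditional Jensen inequality for a finite Young function. -/
theorem apply_condLExp_abs_le (hm : m ≤ m₀) (μ : Measure[m₀] X) [SigmaFinite (μ.trim hm)]
    {Ψ : YoungFunction} (hΨ : Ψ.IsFinite) {g : X → ℝ}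
    (hg : Measurable g) :
    ∀ᵐ x ∂μ, Ψ (condLExp m μ (fun y => ENNReal.ofReal |g y|) x).toReal
      ≤ condLExp m μ (fun y => Ψ (g y)) x := by
  have key : ∀ q : ℚ, 0 ≤ (q : ℝ) → ∀ᵐ x ∂μ,
      (q : ℝ) < (condLExp m μ (fun y => ENNReal.ofReal |g y|) x).toReal →
      Ψ q ≤ condLExp m μ (fun y => Ψ (g y)) x := by
    intro q hq
    obtain ⟨a, ha, hsub⟩ := Ψ.exists_subgradient hΨ hq
    filter_upwards [condLExp_subgradient_le hm μ hg hsub ha] with x hx hlt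
    have h1 : ENNReal.ofReal (a * q)
        ≤ ENNReal.ofReal a * condLExp m μ (fun y => ENNReal.ofReal |g y|) x := by
      rw [ENNReal.ofReal_mul ha]
      gcongr
      exact (ENNReal.ofReal_le_ofReal hlt.le).trans ENNReal.ofReal_toReal_le
    exact (ENNReal.add_le_add_iff_right ENNReal.ofReal_ne_top).1
      ((add_le_add_right h1 _).trans hx)
  have key' : ∀ᵐ x ∂μ, ∀ q : ℚ, 0 ≤ (q : ℝ) →
      (q : ℝ) < (condLExp m μ (fun y => ENNReal.ofReal |g y|) x).toReal →
      Ψ q ≤ condLExp m μ (fun y => Ψ (g y)) x := by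
    rw [ae_all_iff]
    intro q
    by_cases hq : 0 ≤ (q : ℝ)
    · filter_upwards [key q hq] with x hx _
      exact hx
    · exact Eventually.of_forall fun x h => (hq h).elim
  filter_upwards [key'] with x hx
  -- `toReal` sends ∞ to 0, so an infinite conditional expectation falls under the trivial first
  -- case.
  rcases (ENNReal.toReal_nonneg
    (a := condLExp m μ (fun y => ENNReal.ofReal |g y|) x)).eq_or_lt with h0 | h0
  · rw [← h0, Ψ.zero']
    exact zero_le
  · exact Ψ.le_of_forall_rat_lt h0 hx

theorem coeFn_mce (hm : m ≤ m₀) {μ : Measure[m₀] X} (u f : X →ₘ[μ] ℝ) :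
    ∀ᵐ x ∂(μ.trim hm), mce hm μ u f x = condE m μ (fun x => u x * f x) x :=
  @AEEqFun.coeFn_mk X ℝ m (μ.trim hm) _ (condE m μ fun x => u x * f x)
    (measurable_condE m μ _).stronglyMeasurable.aestronglyMeasurable

end CondExp

/-! ### Orlicz-space tools for the operator. -/

section SingleMeasure

variable {X : Type*} {m : MeasurableSpace X} {ν : Measure X} {Φ Ψ : YoungFunction}

theorem measurableSet_imp_eq {β : Type*} [MeasurableSpace β] [MeasurableSingletonClass β]
    {S : Set X} (hS : MeasurableSet S) {g : X → β} (hg : Measurable g) (c : β) :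
    MeasurableSet {x | x ∈ S → g x = c} := by
  have : {x | x ∈ S → g x = c} = Sᶜ ∪ g ⁻¹' {c} := by
    ext x
    simp [imp_iff_not_or]
  rw [this]
  exact hS.compl.union (hg (measurableSet_singleton c))

namespace RealAEEqFun

/-- Here and below the σ-algebra is implicit and read off from ν, for use with classes over `μ.trim
hm`. -/
theorem coeFn_add (v w : X →ₘ[ν] ℝ) : ⇑(v + w) =ᵐ[ν] v + w := AEEqFun.coeFn_add v w

theorem coeFn_smul (c : ℝ) (v : X →ₘ[ν] ℝ) : ⇑(c • v) =ᵐ[ν] c • ⇑v := AEEqFun.coeFn_smul c v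

theorem coeFn_zero : ⇑(0 : X →ₘ[ν] ℝ) =ᵐ[ν] 0 := AEEqFun.coeFn_zero

theorem ext {v w : X →ₘ[ν] ℝ} (h : v =ᵐ[ν] w) : v = w := AEEqFun.ext h

end RealAEEqFun

namespace OrliczSpace

/-- Convexity halves the modular. The bound 2 arises because Young's inequality yields a sum of two
modulars, each at most 1. -/
theorem norm_le_two_mul {g : OrliczSpace Ψ ν} {k : ℝ} (hk : 0 < k)
    (h : ∫⁻ x, Ψ (k⁻¹ * g.toAEEqFun x) ∂ν ≤ 2) : ‖g‖ ≤ 2 * k := by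
  apply norm_le_of_lintegral_le (by positivity)
  calc ∫⁻ x, Ψ (g.toAEEqFun x / (2 * k)) ∂ν
      ≤ ∫⁻ x, ENNReal.ofReal (1 / 2) * Ψ (k⁻¹ * g.toAEEqFun x) ∂ν := by
        refine lintegral_mono fun x => ?_
        have e : g.toAEEqFun x / (2 * k) = 1 / 2 * (k⁻¹ * g.toAEEqFun x) := by
          field_simp
        rw [e]
        exact Ψ.apply_mul_le (by norm_num) (by norm_num) _
    _ = ENNReal.ofReal (1 / 2) * ∫⁻ x, Ψ (k⁻¹ * g.toAEEqFun x) ∂ν :=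
        lintegral_const_mul _ (Ψ.measurable.comp (g.toAEEqFun.measurable.const_mul _))
    _ ≤ ENNReal.ofReal (1 / 2) * 2 := by gcongr
    _ = 1 := by
        rw [← ENNReal.ofReal_ofNat 2, ← ENNReal.ofReal_mul (by norm_num)]
        simp

/-- The inclusion of `L^Ψ` into the space of classes of measurable functions. -/
def toAEEqFunLin (Ψ : YoungFunction) (ν : Measure X) : OrliczSpace Ψ ν →ₗ[ℝ] (X →ₘ[ν] ℝ) where
  toFun := toAEEqFun
  map_add' _ _ := rfl
  map_smul' _ _ := rfl

theorem toAEEqFunLin_injective : Function.Injective (toAEEqFunLin Ψ ν) :=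
  fun _ _ h => Subtype.ext h

/-- The product of an element of `L^Φ` with the indicator function of a measurable set. -/
noncomputable def indicator {S : Set X} (hS : MeasurableSet S) (f : OrliczSpace Φ ν) :
    OrliczSpace Φ ν :=
  ⟨indicatorLin ν S hS f.toAEEqFun, by
    obtain ⟨k, hk, hf⟩ := f.2
    refine ⟨k, hk, lt_of_le_of_lt (lintegral_mono_ae ?_) hf⟩
    filter_upwards [coeFn_indicatorLin hS f.toAEEqFun] with x hx
    rw [hx]
    by_cases h : x ∈ S
    · rw [indicator_of_mem h]
      rfl
    · rw [indicator_of_notMem h, mul_zero, Φ.zero']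
      exact zero_le⟩

theorem coeFn_indicator {S : Set X} (hS : MeasurableSet S) (f : OrliczSpace Φ ν) :
    (f.indicator hS).toAEEqFun =ᵐ[ν] S.indicator f.toAEEqFun :=
  coeFn_indicatorLin hS f.toAEEqFun

theorem exists_coeFn_eq_indicator_one (Φ : YoungFunction) {S : Set X} (hS : MeasurableSet S)
    (hfin : ν S < ∞) : ∃ f : OrliczSpace Φ ν, f.toAEEqFun =ᵐ[ν] S.indicator fun _ => (1 : ℝ) := by
  have hm : Measurable (S.indicator fun _ => (1 : ℝ)) := measurable_const.indicator hS
  refine ⟨⟨AEEqFun.mk _ hm.aestronglyMeasurable, ?_⟩, AEEqFun.coeFn_mk _ _⟩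
  obtain ⟨k, hk, hΦk⟩ := Φ.exists_ne_top'
  refine ⟨k, hk, ?_⟩
  calc ∫⁻ x, Φ (k * (AEEqFun.mk _ hm.aestronglyMeasurable : X →ₘ[ν] ℝ) x) ∂ν
      = ∫⁻ x, S.indicator (fun _ => Φ k) x ∂ν := by
        apply lintegral_congr_ae
        filter_upwards [AEEqFun.coeFn_mk (μ := ν) _ hm.aestronglyMeasurable] with x hx
        rw [hx]
        by_cases h : x ∈ S <;> simp [h, Φ.zero']
    _ = Φ k * ν S := lintegral_indicator_const hS _
    _ < ∞ := ENNReal.mul_lt_top (lt_top_iff_ne_top.2 hΦk) hfin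

end OrliczSpace

theorem exists_disjoint_seq_of_not_finiteDimensional_range {E : Type*} [AddCommGroup E]
    [Module ℝ E] (T : E →ₗ[ℝ] OrliczSpace Ψ ν) (hT : ¬ FiniteDimensional ℝ (LinearMap.range T)) :
    ∃ D : ℕ → Set X, Pairwise (Function.onFun Disjoint D) ∧ (∀ n, MeasurableSet (D n)) ∧
      ∀ n, ∃ f, ¬ ∀ᵐ x ∂ν, x ∈ D n → (T f).toAEEqFun x = 0 := by
  have hV : ¬ FiniteDimensional ℝ ((LinearMap.range T).map (OrliczSpace.toAEEqFunLin Ψ ν)) :=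
    fun _ => hT (Module.Finite.equiv (Submodule.equivMapOfInjective _
      OrliczSpace.toAEEqFunLin_injective (LinearMap.range T)).symm)
  obtain ⟨D, hD, hDV⟩ := exists_disjoint_seq_of_not_finiteDimensional _ hV
  refine ⟨D, hD, fun n => (hDV n).1, fun n => ?_⟩
  obtain ⟨-, _, ⟨_, ⟨f, rfl⟩, rfl⟩, hv⟩ := hDV n
  exact ⟨f, hv⟩

end SingleMeasure

/-! ### The operator EM_u: boundedness, closed range, finite rank. -/

section Operator

variable {X : Type*} {m m₀ : MeasurableSpace X} {μ : Measure[m₀] X} {Φ Ψ Θ : YoungFunction}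
  {u : X →ₘ[μ] ℝ}

theorem apply_mul_mul_le (hineq : ∀ x y : ℝ, 0 ≤ x → 0 ≤ y → Ψ (x * y) ≤ Φ x + Θ y) (x y : ℝ) :
    Ψ (x * y) ≤ Φ x + Θ y := by
  have := hineq |x| |y| (abs_nonneg _) (abs_nonneg _)
  rwa [← abs_mul, Ψ.apply_abs, Φ.apply_abs, Θ.apply_abs] at this

/-- The scales k and c stay independent: k is fitted to f, while c may be huge if S is small for
Θ(cu). -/
theorem setLIntegral_young_mul_le (hineq : ∀ x y : ℝ, 0 ≤ x → 0 ≤ y → Ψ (x * y) ≤ Φ x + Θ y)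
    (f : X →ₘ[μ] ℝ) (k c : ℝ) (S : Set X) :
    ∫⁻ x in S, Ψ (k * c * (u x * f x)) ∂μ
      ≤ ∫⁻ x, Φ (k * f x) ∂μ + ∫⁻ x in S, Θ (c * u x) ∂μ := by
  calc ∫⁻ x in S, Ψ (k * c * (u x * f x)) ∂μ
      ≤ ∫⁻ x in S, (Φ (k * f x) + Θ (c * u x)) ∂μ := by
        refine lintegral_mono fun x => ?_
        have e : k * c * (u x * f x) = k * f x * (c * u x) := by ring
        rw [e]
        exact apply_mul_mul_le hineq _ _
    _ = ∫⁻ x in S, Φ (k * f x) ∂μ + ∫⁻ x in S, Θ (c * u x) ∂μ :=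
        lintegral_add_left (Φ.measurable.comp (f.measurable.const_mul k)) _
    _ ≤ _ := by
        exact add_le_add_left (setLIntegral_le_lintegral _ _) _

theorem condLExp_abs_mul_lt_top (hm : m ≤ m₀) [SigmaFinite (μ.trim hm)] (hΨ : Ψ.IsFinite)
    (hΘ2 : Θ.DeltaTwo) (hineq : ∀ x y : ℝ, 0 ≤ x → 0 ≤ y → Ψ (x * y) ≤ Φ x + Θ y)
    (hu : u ∈ orliczSubmodule Θ μ) (f : OrliczSpace Φ μ) :
    ∀ᵐ x ∂μ, condLExp m μ (fun y => ENNReal.ofReal |u y * f.toAEEqFun y|) x < ∞ := by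
  obtain ⟨k, hk, hf⟩ := f.2
  have hmeas : Measurable fun y => k * 1 * (u y * f.toAEEqFun y) :=
    (u.measurable.mul f.toAEEqFun.measurable).const_mul _
  have h1 := setLIntegral_young_mul_le (u := u) hineq f.toAEEqFun k 1 univ
  simp only [Measure.restrict_univ] at h1
  have h2 := h1.trans_lt (ENNReal.add_lt_top.2 ⟨hf, hΘ2.lintegral_lt_top hu 1⟩)
  have h3 := condLExp_abs_lt_top hm μ hΨ hmeas (condLExp_lt_top h2.ne)
  have e : (fun y => ENNReal.ofReal |k * 1 * (u y * f.toAEEqFun y)|)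
      = ENNReal.ofReal k • fun y => ENNReal.ofReal |u y * f.toAEEqFun y| := by
    funext y
    rw [mul_one, abs_mul, abs_of_pos hk, ENNReal.ofReal_mul hk.le]
    rfl
  rw [e] at h3
  filter_upwards [h3, condLExp_smul' (mΩ := m) (P := μ)
    (fun y => ENNReal.ofReal |u y * f.toAEEqFun y|) (ENNReal.ofReal_ne_top (r := k))] with x h4 h5
  rw [h5, Pi.smul_apply, smul_eq_mul] at h4
  exact ENNReal.lt_top_of_mul_ne_top_right h4.ne (ENNReal.ofReal_pos.2 hk).ne'

/-- Jensen moves Ψ inside the conditional expectation, integration over S ∈ 𝒜 removes the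
expectation, and Young's inequality separates f from u. -/
theorem setLIntegral_young_mce_le (hm : m ≤ m₀) [SigmaFinite (μ.trim hm)] (hΨ : Ψ.IsFinite)
    (hineq : ∀ x y : ℝ, 0 ≤ x → 0 ≤ y → Ψ (x * y) ≤ Φ x + Θ y) {f : X →ₘ[μ] ℝ}
    (hf : ∀ᵐ x ∂μ, condLExp m μ (fun y => ENNReal.ofReal |u y * f y|) x < ∞) (k c : ℝ)
    {S : Set X} (hS : MeasurableSet[m] S) :
    ∫⁻ x in S, Ψ (k * c * mce hm μ u f x) ∂(μ.trim hm)
      ≤ ∫⁻ x, Φ (k * f x) ∂μ + ∫⁻ x in S, Θ (c * u x) ∂μ := by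
  have hcm : Measurable[m] fun x => Ψ (k * c * condE m μ (fun x => u x * f x) x) :=
    Ψ.measurable.comp (Measurable.const_mul (measurable_condE m μ _) _)
  have hgm : Measurable fun y => k * c * (u y * f y) := (u.measurable.mul f.measurable).const_mul _
  have hfin : ∀ᵐ x ∂μ, condLExp m μ (fun y => ENNReal.ofReal |k * c * (u y * f y)|) x < ∞ := by
    have e : (fun y => ENNReal.ofReal |k * c * (u y * f y)|)
        = ENNReal.ofReal |k * c| • fun y => ENNReal.ofReal |u y * f y| := by
      funext y
      rw [abs_mul, ENNReal.ofReal_mul (abs_nonneg _)]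
      rfl
    rw [e]
    filter_upwards [hf, condLExp_smul' (mΩ := m) (P := μ) (fun y => ENNReal.ofReal |u y * f y|)
      (ENNReal.ofReal_ne_top (r := |k * c|))] with x h4 h5
    rw [h5]
    exact ENNReal.mul_lt_top ENNReal.ofReal_lt_top h4
  calc ∫⁻ x in S, Ψ (k * c * mce hm μ u f x) ∂(μ.trim hm)
      = ∫⁻ x in S, Ψ (k * c * condE m μ (fun x => u x * f x) x) ∂(μ.trim hm) := by
        apply lintegral_congr_ae
        filter_upwards [ae_restrict_of_ae (coeFn_mce hm u f)] with x hx
        rw [hx]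
    _ = ∫⁻ x in S, Ψ (k * c * condE m μ (fun x => u x * f x) x) ∂μ := setLIntegral_trim hm hcm hS
    _ ≤ ∫⁻ x in S, condLExp m μ (fun y => Ψ (k * c * (u y * f y))) x ∂μ := by
        apply lintegral_mono_ae
        filter_upwards [ae_restrict_of_ae (condE_const_mul (m := m) (μ := μ) (k * c)
            fun x => u x * f x),
          ae_restrict_of_ae (abs_condE_le hfin),
          ae_restrict_of_ae (apply_condLExp_abs_le hm μ hΨ hgm)] with x h1 h2 h3
        rw [← h1]
        refine (Ψ.mono_abs ?_).trans h3
        rwa [abs_of_nonneg ENNReal.toReal_nonneg]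
    _ = ∫⁻ x in S, Ψ (k * c * (u x * f x)) ∂μ := setLIntegral_condLExp hm μ _ hS
    _ ≤ _ := setLIntegral_young_mul_le hineq f k c S

theorem mce_congr (hm : m ≤ m₀) {f g : X → ℝ} {v : @AEEqFun X ℝ m _ (μ.trim hm)} {w : X →ₘ[μ] ℝ}
    (hwg : (fun x => u x * w x) =ᵐ[μ] g) (hv : v =ᵐ[μ.trim hm] f)
    (hf : Measurable[m] f) (hgf : condE m μ g =ᵐ[μ] f) : mce hm μ u w = v := by
  refine RealAEEqFun.ext ?_
  have h : condE m μ (fun x => u x * w x) =ᵐ[μ.trim hm] f :=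
    ae_eq_trim_of_measurable hm (measurable_condE m μ _) hf ((condE_congr_ae hwg).trans hgf)
  filter_upwards [coeFn_mce hm u w, h, hv] with x h1 h2 h3
  rw [h1, h2, h3]

theorem exists_continuousLinearMap_mce (hm : m ≤ m₀) [SigmaFinite (μ.trim hm)] (hΨ : Ψ.IsFinite)
    (hΘ2 : Θ.DeltaTwo) (hineq : ∀ x y : ℝ, 0 ≤ x → 0 ≤ y → Ψ (x * y) ≤ Φ x + Θ y)
    (hu : u ∈ orliczSubmodule Θ μ) :
    ∃ T : OrliczSpace Φ μ →L[ℝ] OrliczSpace Ψ (μ.trim hm),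
      ∀ f, (T f).toAEEqFun = mce hm μ u f.toAEEqFun := by
  have hfin := fun f : OrliczSpace Φ μ => condLExp_abs_mul_lt_top hm hΨ hΘ2 hineq hu f
  have hmod := fun (f : OrliczSpace Φ μ) (k c : ℝ) =>
    setLIntegral_young_mce_le hm hΨ hineq (hfin f) k c MeasurableSet.univ
  simp only [Measure.restrict_univ] at hmod
  have hmem : ∀ f : OrliczSpace Φ μ, mce hm μ u f.toAEEqFun ∈ orliczSubmodule Ψ (μ.trim hm) := by
    intro f
    obtain ⟨k, hk, hf⟩ := f.2
    refine ⟨k * 1, by simpa using hk, (hmod f k 1).trans_lt ?_⟩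
    exact ENNReal.add_lt_top.2 ⟨hf, hΘ2.lintegral_lt_top hu 1⟩
  have hadd : ∀ f g : OrliczSpace Φ μ, mce hm μ u (f + g).toAEEqFun
      = mce hm μ u f.toAEEqFun + mce hm μ u g.toAEEqFun := by
    intro f g
    refine mce_congr hm (g := fun x => u x * f.toAEEqFun x + u x * g.toAEEqFun x)
      (f := fun x => condE m μ (fun x => u x * f.toAEEqFun x) x
        + condE m μ (fun x => u x * g.toAEEqFun x) x) ?_ ?_ ?_ ?_
    · filter_upwards [AEEqFun.coeFn_add f.toAEEqFun g.toAEEqFun] with x hx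
      rw [OrliczSpace.coe_add, hx, Pi.add_apply, mul_add]
    · filter_upwards [RealAEEqFun.coeFn_add (mce hm μ u f.toAEEqFun) (mce hm μ u g.toAEEqFun),
        coeFn_mce hm u f.toAEEqFun, coeFn_mce hm u g.toAEEqFun] with x h1 h2 h3
      rw [h1, Pi.add_apply, h2, h3]
    · exact Measurable.add (measurable_condE m μ _) (measurable_condE m μ _)
    · exact condE_add (u.measurable.mul f.toAEEqFun.measurable)
        (u.measurable.mul g.toAEEqFun.measurable) (hfin f) (hfin g)
  have hsmul : ∀ (c : ℝ) (f : OrliczSpace Φ μ), mce hm μ u (c • f).toAEEqFun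
      = c • mce hm μ u f.toAEEqFun := by
    intro c f
    refine mce_congr hm (g := fun x => c * (u x * f.toAEEqFun x))
      (f := fun x => c * condE m μ (fun x => u x * f.toAEEqFun x) x) ?_ ?_ ?_ ?_
    · filter_upwards [AEEqFun.coeFn_smul c f.toAEEqFun] with x hx
      rw [OrliczSpace.coe_smul, hx, Pi.smul_apply, smul_eq_mul, mul_left_comm]
    · filter_upwards [RealAEEqFun.coeFn_smul c (mce hm μ u f.toAEEqFun),
        coeFn_mce hm u f.toAEEqFun] with x h1 h2
      rw [h1, Pi.smul_apply, h2, smul_eq_mul]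
    · exact Measurable.const_mul (measurable_condE m μ _) _
    · exact condE_const_mul c _
  let T : OrliczSpace Φ μ →ₗ[ℝ] OrliczSpace Ψ (μ.trim hm) :=
    { toFun := fun f => ⟨mce hm μ u f.toAEEqFun, hmem f⟩
      map_add' := fun f g => Subtype.ext (hadd f g)
      map_smul' := fun c f => Subtype.ext (hsmul c f) }
  -- Any l with ∫ Θ(u/l) ≤ 1 gives the operator bound 2l.
  obtain ⟨l, hl, hul⟩ := OrliczSpace.nonempty_aux (⟨u, hu⟩ : OrliczSpace Θ μ)
  have hul' : ∫⁻ x, Θ (l⁻¹ * u x) ∂μ ≤ 1 := by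
    refine le_of_eq_of_le (lintegral_congr fun x => ?_) hul
    rw [div_eq_inv_mul]
    rfl
  refine ⟨T.mkContinuous (2 * l) fun f => ?_, fun f => rfl⟩
  -- The modular bound is at hand for k > ‖f‖; the norm itself is reached by letting k decrease.
  have hbound : ∀ k, ‖f‖ < k → ‖T f‖ ≤ 2 * l * k := by
    intro k hk
    have hk0 : 0 < k := (norm_nonneg f).trans_lt hk
    rw [mul_assoc]
    apply OrliczSpace.norm_le_two_mul (by positivity)
    have h1 : ∫⁻ x, Φ (k⁻¹ * f.toAEEqFun x) ∂μ ≤ 1 := by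
      refine le_of_eq_of_le (lintegral_congr fun x => ?_)
        (OrliczSpace.lintegral_le_one_of_norm_lt hk)
      rw [div_eq_inv_mul]
    rw [mul_inv_rev]
    exact (hmod f k⁻¹ l⁻¹).trans ((add_le_add h1 hul').trans_eq one_add_one_eq_two)
  have hl2 : 0 < 2 * l := by positivity
  rw [← div_le_iff₀' hl2]
  refine le_of_forall_gt_imp_ge_of_dense fun k hk => ?_
  rw [div_le_iff₀' hl2]
  exact hbound k hk

theorem mce_indicator (hm : m ≤ m₀) [SigmaFinite (μ.trim hm)] {S : Set X}
    (hS : MeasurableSet[m] S) (f : OrliczSpace Φ μ) :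
    mce hm μ u (f.indicator (hm S hS)).toAEEqFun
      =ᵐ[μ.trim hm] S.indicator (mce hm μ u f.toAEEqFun) := by
  have h1 : (fun x => u x * (f.indicator (hm S hS)).toAEEqFun x)
      =ᵐ[μ] S.indicator fun x => u x * f.toAEEqFun x := by
    filter_upwards [OrliczSpace.coeFn_indicator (hm S hS) f] with x hx
    rw [hx]
    by_cases h : x ∈ S <;> simp [h]
  have h2 := ae_eq_trim_of_measurable hm (measurable_condE m μ _)
    (Measurable.indicator (measurable_condE m μ _) hS)
    ((condE_congr_ae (m := m) h1).trans (condE_indicator hm μ hS _))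
  filter_upwards [h2, coeFn_mce hm u (f.indicator (hm S hS)).toAEEqFun,
    coeFn_mce hm u f.toAEEqFun] with x h2 h3 h4
  rw [h3, h2]
  by_cases h : x ∈ S <;> simp [h, h4]

/-- The core of the proof: on sparse enough D_n the function u is too small for a single h to
satisfy Th = 4^-(n+1) b_n on every D_n, with all the b_n of norm 1/2. -/
theorem not_isClosed_range_of_disjoint (hm : m ≤ m₀) [SigmaFinite (μ.trim hm)] (hΨ : Ψ.IsFinite)
    (hΘ2 : Θ.DeltaTwo) (hineq : ∀ x y : ℝ, 0 ≤ x → 0 ≤ y → Ψ (x * y) ≤ Φ x + Θ y)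
    (hu : u ∈ orliczSubmodule Θ μ) (T : OrliczSpace Φ μ →L[ℝ] OrliczSpace Ψ (μ.trim hm))
    (hT : ∀ f, (T f).toAEEqFun = mce hm μ u f.toAEEqFun) {D : ℕ → Set X}
    (hdis : Pairwise (Function.onFun Disjoint D)) (hD : ∀ n, MeasurableSet[m] (D n))
    (hDT : ∀ n, ∃ f, ¬ ∀ᵐ x ∂(μ.trim hm), x ∈ D n → (T f).toAEEqFun x = 0) :
    ¬ IsClosed (range T) := by
  intro hcl
  choose f hf using hDT
  -- The factor 4^(n+1) will cancel the weight of b_n in the series; the factor n makes the final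
  -- bound decay.
  obtain ⟨φ, hφ, hφ1⟩ := exists_subseq_setLIntegral_le_one
    (F := fun n x => Θ ((n * 4 ^ (n + 1) : ℝ) * u x))
    (fun n => hΘ2.lintegral_lt_top hu _) (fun n => hm _ (hD n)) hdis
  set f' : ℕ → OrliczSpace Φ μ := fun n => (f (φ n)).indicator (hm _ (hD (φ n))) with hf'
  have hTf' : ∀ n, (T (f' n)).toAEEqFun =ᵐ[μ.trim hm]
      (D (φ n)).indicator (T (f (φ n))).toAEEqFun := by
    intro n
    rw [hT, hT]
    exact mce_indicator hm (hD (φ n)) _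
  have hne : ∀ n, T (f' n) ≠ 0 := by
    intro n h0
    apply hf (φ n)
    have h1 := hTf' n
    rw [h0] at h1
    filter_upwards [h1, RealAEEqFun.coeFn_zero (ν := μ.trim hm)] with x h1 h2 h3
    rw [indicator_of_mem h3] at h1
    rw [← h1]
    exact h2
  set b : ℕ → OrliczSpace Ψ (μ.trim hm) := fun n => (2 * ‖T (f' n)‖)⁻¹ • T (f' n) with hb
  have hbn : ∀ n, ‖b n‖ = 1 / 2 := by
    intro n
    have : ‖T (f' n)‖ ≠ 0 := norm_ne_zero_iff.2 (hne n)
    simp only [hb]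
    rw [norm_smul, norm_inv, Real.norm_of_nonneg (by positivity)]
    field_simp
  have hsupp : ∀ n, ∀ᵐ x ∂(μ.trim hm), x ∉ D (φ n) → (b n).toAEEqFun x = 0 := by
    intro n
    filter_upwards [hTf' n, RealAEEqFun.coeFn_smul (2 * ‖T (f' n)‖)⁻¹ (T (f' n)).toAEEqFun]
      with x h1 h2 h3
    simp only [hb]
    rw [OrliczSpace.coe_smul, h2, Pi.smul_apply, h1, indicator_of_notMem h3, smul_zero]
  have hcl' : IsClosed (LinearMap.range T.toLinearMap : Set (OrliczSpace Ψ (μ.trim hm))) := by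
    convert hcl
    ext
    simp
  obtain ⟨g, ⟨h, rfl⟩, hg⟩ := OrliczSpace.exists_mem_of_isClosed_of_disjoint_support
    (LinearMap.range T.toLinearMap) hcl' (fun n => hD (φ n))
    (fun i j hij => hdis (hφ.injective.ne hij)) (b := b)
    (fun n => Submodule.smul_mem _ _ ⟨f' n, rfl⟩) (fun n => by rw [hbn]; norm_num) hsupp
  obtain ⟨k, hk, hhk⟩ := h.nonempty_aux
  have hhk' : ∫⁻ x, Φ (k⁻¹ * h.toAEEqFun x) ∂μ ≤ 1 := by
    refine le_of_eq_of_le (lintegral_congr fun x => ?_) hhk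
    rw [div_eq_inv_mul]
  -- The estimate gives 1/2 = ‖b_n‖ ≤ 2k/n, which fails for n > 4k.
  obtain ⟨n, hn⟩ := exists_nat_gt (4 * k)
  have hn0 : (0 : ℝ) < n := by linarith
  have hle : ‖b n‖ ≤ 2 * (k / n) := by
    apply OrliczSpace.norm_le_two_mul (by positivity)
    calc ∫⁻ x, Ψ ((k / n)⁻¹ * (b n).toAEEqFun x) ∂(μ.trim hm)
        = ∫⁻ x in D (φ n), Ψ (k⁻¹ * (n * 4 ^ (n + 1)) * mce hm μ u h.toAEEqFun x)
            ∂(μ.trim hm) := by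
          rw [← lintegral_indicator (hD (φ n))]
          apply lintegral_congr_ae
          filter_upwards [hg n, hsupp n] with x h1 h2
          by_cases hx : x ∈ D (φ n)
          · have h3 := h1 hx
            change (T h).toAEEqFun x = _ at h3
            rw [indicator_of_mem hx, ← hT, h3]
            congr 1
            have h4 : (4 : ℝ) ^ (n + 1) * (1 / 4) ^ (n + 1) = 1 := by
              rw [← mul_pow]; norm_num
            rw [inv_div, div_eq_inv_mul]
            linear_combination (-(k⁻¹ * n * (b n).toAEEqFun x)) * h4
          · rw [indicator_of_notMem hx, h2 hx, mul_zero, Ψ.zero']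
      _ ≤ ∫⁻ x, Φ (k⁻¹ * h.toAEEqFun x) ∂μ
          + ∫⁻ x in D (φ n), Θ ((n * 4 ^ (n + 1) : ℝ) * u x) ∂μ :=
          setLIntegral_young_mce_le hm hΨ hineq
            (condLExp_abs_mul_lt_top hm hΨ hΘ2 hineq hu h) _ _ (hD (φ n))
      _ ≤ 2 := (add_le_add hhk' (hφ1 n)).trans_eq one_add_one_eq_two
  rw [hbn, ← mul_div_assoc, le_div_iff₀ hn0] at hle
  linarith

/-- Test with indicators of the finite-measure spanning sets, which lie in L^Φ. As u ≥ 0 there is no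
cancellation, so E(u 1_R) = 0 on S forces u = 0 on S ∩ R. -/
theorem ae_eq_zero_of_forall_mce (hm : m ≤ m₀) [SigmaFinite (μ.trim hm)] (hu0 : 0 ≤ u)
    (hfin : ∀ f : OrliczSpace Φ μ, ∀ᵐ x ∂μ,
      condLExp m μ (fun y => ENNReal.ofReal |u y * f.toAEEqFun y|) x < ∞)
    {S : Set X} (hS : MeasurableSet[m] S)
    (h : ∀ f : OrliczSpace Φ μ, ∀ᵐ x ∂(μ.trim hm), x ∈ S → mce hm μ u f.toAEEqFun x = 0) :
    ∀ᵐ x ∂μ, x ∈ S → u x = 0 := by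
  have key : ∀ n, ∀ᵐ x ∂μ, x ∈ S → x ∈ spanningSets (μ.trim hm) n → u x = 0 := by
    intro n
    set R := spanningSets (μ.trim hm) n
    have hR : MeasurableSet[m] R := measurableSet_spanningSets _ n
    have hRfin : μ R < ∞ := by
      rw [← trim_measurableSet_eq hm hR]
      exact measure_spanningSets_lt_top _ n
    obtain ⟨f, hf⟩ := OrliczSpace.exists_coeFn_eq_indicator_one Φ (hm R hR) hRfin
    have hnn : ∀ᵐ x ∂μ, 0 ≤ u x * f.toAEEqFun x := by
      filter_upwards [AEEqFun.coeFn_le.2 hu0, AEEqFun.coeFn_zero (β := ℝ) (μ := μ), hf]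
        with x h1 h2 h3
      rw [h2] at h1
      rw [h3]
      exact mul_nonneg h1 (indicator_nonneg (fun _ _ => zero_le_one) x)
    have hneg : condLExp m μ (fun y => ENNReal.ofReal (-(u y * f.toAEEqFun y))) =ᵐ[μ] 0 := by
      have : (fun y => ENNReal.ofReal (-(u y * f.toAEEqFun y))) =ᵐ[μ] (0 : X → ℝ≥0∞) := by
        filter_upwards [hnn] with x hx
        exact ENNReal.ofReal_of_nonpos (neg_nonpos.2 hx)
      exact (condLExp_congr_ae this).trans (by rw [condLExp_zero])
    have hpos : condLExp m μ (fun y => ENNReal.ofReal (u y * f.toAEEqFun y))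
        =ᵐ[μ] condLExp m μ fun y => ENNReal.ofReal |u y * f.toAEEqFun y| := by
      refine condLExp_congr_ae ?_
      filter_upwards [hnn] with x hx
      rw [abs_of_nonneg hx]
    have hE : ∀ᵐ x ∂μ, x ∈ S →
        condLExp m μ (fun y => ENNReal.ofReal |u y * f.toAEEqFun y|) x = 0 := by
      filter_upwards [ae_of_ae_trim hm (h f), ae_of_ae_trim hm (coeFn_mce hm u f.toAEEqFun),
        hneg, hpos, hfin f] with x h1 h2 h3 h4 h5 hx
      have h6 := h1 hx
      rw [h2] at h6
      simp only [condE] at h6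
      rw [h3, h4, Pi.zero_apply, ENNReal.toReal_zero, sub_zero, ENNReal.toReal_eq_zero_iff] at h6
      exact h6.resolve_right h5.ne
    have hmeas : Measurable fun y => ENNReal.ofReal |u y * f.toAEEqFun y| :=
      (measurable_norm.comp (u.measurable.mul f.toAEEqFun.measurable)).ennreal_ofReal
    rw [condLExp_eq_zero_on_iff hm μ hS hmeas] at hE
    filter_upwards [hE, hf] with x h1 h2 hxS hxR
    have h3 := h1 hxS
    rw [h2, indicator_of_mem hxR, mul_one, ENNReal.ofReal_eq_zero] at h3
    exact abs_nonpos_iff.1 h3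
  filter_upwards [ae_all_iff.2 key] with x hx hxS
  obtain ⟨n, hn⟩ := mem_iUnion.1
    ((iUnion_spanningSets (μ.trim hm)).symm ▸ mem_univ x : x ∈ ⋃ i, spanningSets (μ.trim hm) i)
  exact hx n hxS hn

theorem mce_eq_zero_of_ae_eq_zero (hm : m ≤ m₀) [SigmaFinite (μ.trim hm)]
    {S : Set X} (hS : MeasurableSet[m] S) (hu : ∀ᵐ x ∂μ, x ∈ S → u x = 0) (f : X →ₘ[μ] ℝ) :
    ∀ᵐ x ∂(μ.trim hm), x ∈ S → mce hm μ u f x = 0 := by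
  have hmeas : Measurable fun y => u y * f y := u.measurable.mul f.measurable
  have h1 := (condLExp_eq_zero_on_iff hm μ hS hmeas.ennreal_ofReal).2 (by
    filter_upwards [hu] with x hx hxS
    simp [hx hxS])
  have h2 := (condLExp_eq_zero_on_iff hm μ hS hmeas.neg.ennreal_ofReal).2 (by
    filter_upwards [hu] with x hx hxS
    simp [hx hxS])
  have h3 : ∀ᵐ x ∂(μ.trim hm), x ∈ S → condE m μ (fun y => u y * f y) x = 0 := by
    refine ae_trim_of_ae hm (measurableSet_imp_eq hS (measurable_condE m μ _) 0) ?_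
    filter_upwards [h1, h2] with x h1 h2 hxS
    simp only [Pi.neg_apply] at h2
    simp only [condE]
    rw [h1 hxS, h2 hxS]
    simp
  filter_upwards [h3, coeFn_mce hm u f] with x h3 h4 hxS
  rw [h4, h3 hxS]

theorem condLExp_compl_eq_zero_on_iff (hm : m ≤ m₀) [SigmaFinite (μ.trim hm)]
    {S : Set X} (hS : MeasurableSet[m] S) :
    (∀ᵐ x ∂(μ.trim hm), x ∈ S → condLExp m μ (fun y => Φ.compl (u y)) x = 0) ↔
      ∀ᵐ x ∂μ, x ∈ S → Φ.compl (u x) = 0 := by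
  have hmeas : Measurable fun y => Φ.compl (u y) := Φ.measurable_compl.comp u.measurable
  rw [← condLExp_eq_zero_on_iff hm μ hS hmeas]
  exact ⟨ae_of_ae_trim hm, ae_trim_of_ae hm
    (measurableSet_imp_eq hS (measurable_condLExp m μ _) 0)⟩

theorem exists_mce_ne_zero (hm : m ≤ m₀) [SigmaFinite (μ.trim hm)] (hu0 : 0 ≤ u)
    (hfin : ∀ f : OrliczSpace Φ μ, ∀ᵐ x ∂μ,
      condLExp m μ (fun y => ENNReal.ofReal |u y * f.toAEEqFun y|) x < ∞)
    {S : Set X} (hS : MeasurableSet[m] S) (hS0 : μ.trim hm S ≠ 0)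
    (hE : ∀ᵐ x ∂(μ.trim hm), x ∈ S → condLExp m μ (fun y => Φ.compl (u y)) x ≠ 0) :
    ∃ f : OrliczSpace Φ μ, ¬ ∀ᵐ x ∂(μ.trim hm), x ∈ S → mce hm μ u f.toAEEqFun x = 0 := by
  by_contra hcon
  have h1 : ∀ f : OrliczSpace Φ μ,
      ∀ᵐ x ∂(μ.trim hm), x ∈ S → mce hm μ u f.toAEEqFun x = 0 := by
    intro f
    by_contra hf
    exact hcon ⟨f, hf⟩
  have h2 := ae_eq_zero_of_forall_mce hm hu0 hfin hS h1
  have h3 := (condLExp_compl_eq_zero_on_iff (Φ := Φ) (u := u) hm hS).2 (by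
    filter_upwards [h2] with x hx hxS
    rw [hx hxS, Φ.compl_zero])
  apply hS0
  have h4 : ∀ᵐ x ∂(μ.trim hm), x ∉ S := by
    filter_upwards [hE, h3] with x h5 h6 hxS
    exact h5 hxS (h6 hxS)
  rw [ae_iff] at h4
  simpa using h4

theorem nonzeroOnlyOnFinitelyMany_of_isClosed_range (hm : m ≤ m₀) [SigmaFinite (μ.trim hm)]
    (hΨ : Ψ.IsFinite) (hΘ2 : Θ.DeltaTwo)
    (hineq : ∀ x y : ℝ, 0 ≤ x → 0 ≤ y → Ψ (x * y) ≤ Φ x + Θ y)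
    (hu : u ∈ orliczSubmodule Θ μ) (hu0 : 0 ≤ u)
    (T : OrliczSpace Φ μ →L[ℝ] OrliczSpace Ψ (μ.trim hm))
    (hT : ∀ f, (T f).toAEEqFun = mce hm μ u f.toAEEqFun) {𝒮 : Set (Set X)}
    (h𝒮 : IsAtomicDecomposition (μ.trim hm) 𝒮) (hcl : IsClosed (range T)) :
    NonzeroOnlyOnFinitelyMany (μ.trim hm) 𝒮 (condLExp m μ fun y => Φ.compl (u y)) := by
  obtain ⟨hcount, hpd, hatom, hnone⟩ := h𝒮
  have hfin := fun f : OrliczSpace Φ μ => condLExp_abs_mul_lt_top hm hΨ hΘ2 hineq hu f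
  set g := condLExp m μ fun y => Φ.compl (u y) with hg
  have hgm : Measurable[m] g := measurable_condLExp m μ _
  -- Where E(Φ*(u)) ≠ 0, u is not a.e. zero, so some Tf is nonzero there. Both ways in which (a) can
  -- fail supply such a sequence D.
  have hkey : ∀ D : ℕ → Set X, Pairwise (Function.onFun Disjoint D) →
      (∀ n, MeasurableSet[m] (D n)) → (∀ n, μ.trim hm (D n) ≠ 0) →
      ¬ ∀ n, ∀ᵐ x ∂(μ.trim hm), x ∈ D n → g x ≠ 0 := by
    intro D hdis hD hD0 hDg
    refine not_isClosed_range_of_disjoint hm hΨ hΘ2 hineq hu T hT hdis hD (fun n => ?_) hcl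
    simp only [hT]
    exact exists_mce_ne_zero hm hu0 hfin (hD n) (hD0 n) (hDg n)
  have hB : MeasurableSet[m] (⋃₀ 𝒮)ᶜ :=
    MeasurableSet.compl (m := m) (MeasurableSet.sUnion hcount fun A hA => (hatom A hA).1)
  have hN : MeasurableSet[m] {x | g x ≠ 0} :=
    MeasurableSet.compl (m := m) (hgm (measurableSet_singleton 0))
  constructor
  · by_contra hcon
    have hS0 : μ.trim hm ((⋃₀ 𝒮)ᶜ ∩ {x | g x ≠ 0}) ≠ 0 := by
      intro h0
      apply hcon
      refine measure_mono_null (fun x hx => ?_) h0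
      simpa using hx
    obtain ⟨D, hdis, hD⟩ := exists_disjoint_seq_of_no_atoms hnone inter_subset_left
      (MeasurableSet.inter (m := m) hB hN) hS0
    exact hkey D hdis (fun n => (hD n).2.1) (fun n => (hD n).2.2)
      fun n => Eventually.of_forall fun x hx => ((hD n).1 hx).2
  · by_contra hinf
    have e := Set.Infinite.natEmbedding _ hinf
    refine hkey (fun n => (e n : Set X)) (fun i j hij => hpd (e i).2.1 (e j).2.1 ?_)
      (fun n => (hatom _ (e n).2.1).1) (fun n => (hatom _ (e n).2.1).2.1.ne') fun n => ?_
    · exact fun h => hij (e.injective (Subtype.ext h))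
    · obtain ⟨c, hc, hgc⟩ := (e n).2.2
      rw [ae_restrict_iff' (hatom _ (e n).2.1).1] at hgc
      filter_upwards [hgc] with x hx hxA
      rw [hx hxA]
      exact hc

/-- Pigeonhole: infinitely many disjoint sets would each meet one of finitely many atoms in positive
measure, so two of them would share an atom. -/
theorem finiteDimensional_range_of_nonzeroOnlyOnFinitelyMany (hm : m ≤ m₀)
    [SigmaFinite (μ.trim hm)] (T : OrliczSpace Φ μ →L[ℝ] OrliczSpace Ψ (μ.trim hm))
    (hT : ∀ f, (T f).toAEEqFun = mce hm μ u f.toAEEqFun) {𝒮 : Set (Set X)}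
    (h𝒮 : IsAtomicDecomposition (μ.trim hm) 𝒮) (hΦ : ∀ y : ℝ, Φ.compl y = 0 → y = 0)
    (hnz : NonzeroOnlyOnFinitelyMany (μ.trim hm) 𝒮 (condLExp m μ fun y => Φ.compl (u y))) :
    FiniteDimensional ℝ (LinearMap.range T.toLinearMap) := by
  obtain ⟨hcount, hpd, hatom, hnone⟩ := h𝒮
  obtain ⟨hB, hF⟩ := hnz
  set g := condLExp m μ fun y => Φ.compl (u y) with hg
  have hgm : Measurable[m] g := measurable_condLExp m μ _
  set F := {A ∈ 𝒮 | ∃ c : ℝ≥0∞, c ≠ 0 ∧ ∀ᵐ x ∂(μ.trim hm).restrict A, g x = c} with hFdef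
  by_contra hfd
  obtain ⟨D, hdis, hD, hDT⟩ := exists_disjoint_seq_of_not_finiteDimensional_range _ hfd
  have hA0 : ∀ A ∈ 𝒮, A ∉ F → ∀ᵐ x ∂(μ.trim hm), x ∈ A → g x = 0 := by
    intro A hA hAF
    obtain ⟨c, hc⟩ := (hatom A hA).ae_const hgm
    by_cases hc0 : c = 0
    · rwa [hc0] at hc
    · exact (hAF ⟨hA, c, hc0, (ae_restrict_iff' (hatom A hA).1).2 hc⟩).elim
  -- Otherwise E(Φ*(u)) = 0 a.e. on D n; then Φ*(u) = 0 and u = 0 there, and every Tf vanishes on D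
  -- n.
  have hmeet : ∀ n, ∃ A : F, μ.trim hm (D n ∩ A) ≠ 0 := by
    intro n
    by_contra! hnull
    obtain ⟨f, hf⟩ := hDT n
    apply hf
    have hgD : ∀ᵐ x ∂(μ.trim hm), x ∈ D n → g x = 0 := by
      have h1 : ∀ᵐ x ∂(μ.trim hm), ∀ A ∈ 𝒮, x ∈ D n → x ∈ A → g x = 0 := by
        rw [ae_ball_iff hcount]
        intro A hA
        by_cases hAF : A ∈ F
        · have h2 : ∀ᵐ x ∂(μ.trim hm), x ∉ D n ∩ A := by
            rw [ae_iff]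
            simpa using hnull ⟨A, hAF⟩
          filter_upwards [h2] with x hx h3 h4
          exact (hx ⟨h3, h4⟩).elim
        · filter_upwards [hA0 A hA hAF] with x hx _ h4
          exact hx h4
      filter_upwards [hB, h1] with x h1 h2 hx
      by_cases hxU : x ∈ ⋃₀ 𝒮
      · obtain ⟨A, hA, hxA⟩ := hxU
        exact h2 A hA hx hxA
      · exact h1 hxU
    have huD : ∀ᵐ x ∂μ, x ∈ D n → u x = 0 := by
      filter_upwards [(condLExp_compl_eq_zero_on_iff hm (hD n)).1 hgD] with x hx hxD
      exact hΦ _ (hx hxD)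
    have := mce_eq_zero_of_ae_eq_zero hm (hD n) huD f.toAEEqFun
    rw [← hT] at this
    exact this
  choose A hA using hmeet
  have : Finite F := hF
  obtain ⟨i, j, hij, hAij⟩ := Finite.exists_ne_map_eq_of_infinite A
  exact (hatom _ (A i).2.1).not_disjoint (hD i) (hA i) (hAij ▸ hA j) (hdis hij)

end Operator

/-! ### The theorem. -/

theorem theorem3p2 {X : Type*} {m m₀ : MeasurableSpace X} (hm : m ≤ m₀) (μ : Measure[m₀] X)
    [SigmaFinite (μ.trim hm)] (Φ Ψ Θ : YoungFunction)
    (hΦ0 : Φ.VanishesOnlyAtZero) (hΨ0 : Ψ.VanishesOnlyAtZero) (hΘ0 : Θ.VanishesOnlyAtZero)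
    (hΦfin : Φ.IsFinite) (hΨfin : Ψ.IsFinite) (hΘfin : Θ.IsFinite)
    (hΨ2 : Ψ.DeltaTwo) (hΘ2 : Θ.DeltaTwo)
    (hineq : ∀ x y : ℝ, 0 ≤ x → 0 ≤ y → Ψ (x * y) ≤ Φ x + Θ y)
    (u : X →ₘ[μ] ℝ) (hu : u ∈ orliczSubmodule Θ μ) (hu0 : 0 ≤ u) :
    -- `E(uf)` is well defined for every `f ∈ L^Φ(Σ)`
    (∀ f : OrliczSpace Φ μ, ∀ᵐ x ∂μ,
      condLExp m μ (fun y => ENNReal.ofReal |u y * f.toAEEqFun y|) x < ∞) ∧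
    -- `EM_u` is a bounded linear operator `T` from `L^Φ(Σ)` into `L^Ψ(𝒜)`
    ∃ T : OrliczSpace Φ μ →L[ℝ] OrliczSpace Ψ (μ.trim hm),
      (∀ f : OrliczSpace Φ μ, (T f).toAEEqFun = mce hm μ u f.toAEEqFun) ∧
      (FiniteDimensional ℝ (LinearMap.range T.toLinearMap) ↔ IsClosed (Set.range T)) ∧
      -- for every decomposition of `(X, 𝒜, μ)` into atoms and the non-atomic part `B = (⋃₀ 𝒮)ᶜ`
      ∀ 𝒮 : Set (Set X), IsAtomicDecomposition (μ.trim hm) 𝒮 →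
        (IsClosed (Set.range T) →
          NonzeroOnlyOnFinitelyMany (μ.trim hm) 𝒮 (condLExp m μ fun y => Φ.compl (u y))) ∧
        ((∀ y : ℝ, Φ.compl y = 0 → y = 0) →
          List.TFAE [
            NonzeroOnlyOnFinitelyMany (μ.trim hm) 𝒮 (condLExp m μ fun y => Φ.compl (u y)),
            FiniteDimensional ℝ (LinearMap.range T.toLinearMap),
            IsClosed (Set.range T)]) := by
  have hfin := fun f : OrliczSpace Φ μ => condLExp_abs_mul_lt_top hm hΨfin hΘ2 hineq hu f
  refine ⟨hfin, ?_⟩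
  obtain ⟨T, hT⟩ := exists_continuousLinearMap_mce hm hΨfin hΘ2 hineq hu
  have hbc : FiniteDimensional ℝ (LinearMap.range T.toLinearMap) → IsClosed (Set.range T) :=
    fun _ => (LinearMap.range T.toLinearMap).closed_of_finiteDimensional
  have hcb : IsClosed (Set.range T) → FiniteDimensional ℝ (LinearMap.range T.toLinearMap) := by
    intro hcl
    by_contra hfd
    obtain ⟨D, hdis, hD, hDT⟩ := exists_disjoint_seq_of_not_finiteDimensional_range _ hfd
    exact not_isClosed_range_of_disjoint hm hΨfin hΘ2 hineq hu T hT hdis hD hDT hcl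
  refine ⟨T, hT, ⟨hbc, hcb⟩, fun 𝒮 h𝒮 => ?_⟩
  have hca := nonzeroOnlyOnFinitelyMany_of_isClosed_range hm hΨfin hΘ2 hineq hu hu0 T hT h𝒮
  refine ⟨hca, fun hΦs => ?_⟩
  tfae_have 1 → 2 :=
    finiteDimensional_range_of_nonzeroOnlyOnFinitelyMany hm T hT h𝒮 hΦs
  tfae_have 2 → 3 := hbc
  tfae_have 3 → 1 := hca
  tfae_finish
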